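/- Let $(N^m(4\epsilon),J,\langle\cdot,\cdot\rangle)$ be a complex space form of complex dimension $m$ and constant holomorphic sectional curvature $4\epsilon$, i.e. a Kähler manifold with $\langle R^N(U,JU)JU,U\rangle=4\epsilon\,|U|^4$ for all tangent vectors $U$, where $R^N(U,V)=\nabla^N_U\nabla^N_V-\nabla^N_V\nabla^N_U-\nabla^N_{[U,V]}$. Let $(M^m,g)$ be a Riemannian manifold of real dimension $m$ and $\phi:(M,g)\to N^m(4\epsilon)$ a smooth Lagrangian isometric immersion, that is, $J\,d\phi(T_xM)\perp d\phi(T_xM)$ for all $x\in M$. Let $\overline\nabla$ be the connection induced on $\phi^{-1}TN$, let $B(X,Y)=\overline\nabla_X d\phi(Y)-d\phi(\nabla_XY)$ be the second fundamental form, $\mathbf H=\frac1m\,\mathrm{trace}_g B$ the mean curvature vector field, and let the shape operator $A_\xi$ and the normal connection $\nabla^\perp$ be given by $\overline\nabla_X\xi=-d\phi(A_\xi X)+\nabla^\perp_X\xi$ (tangential and normal parts). Put $\overline\Delta V=-\sum_{i=1}^m(\overline\nabla_{e_i}\overline\nabla_{e_i}V-\overline\nabla_{\nabla_{e_i}e_i}V)$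 and $\Delta^\perp\xi=-\sum_{i=1}^m(\nabla^\perp_{e_i}\nabla^\perp_{e_i}\xi-\nabla^\perp_{\nabla_{e_i}e_i}\xi)$ for a local orthonormal frame $(e_i)$ of $M$. The map $\phi$ is called biharmonic if its bitension field vanishes, i.e. if $$\tau_2(\phi)=\overline\Delta\,\tau(\phi)-\sum_{i=1}^m R^N(\tau(\phi),d\phi(e_i))\,d\phi(e_i)=0,$$ where $\tau(\phi)=\mathrm{trace}_g(\overline\nabla_{\cdot}\, d\phi(\cdot)-d\phi(\nabla_\cdot\,\cdot))$ is the tension field. Then $\phi$ is biharmonic if and only if both of the following equations hold on $M$: $$\mathrm{trace}_g(\nabla A_{\mathbf H})+\mathrm{trace}_g\big(A_{\nabla^\perp_{\cdot}\mathbf H}(\cdot)\big)=0,$$ $$\Delta^\perp\mathbf H+\mathrm{trace}_g B(A_{\mathbf H}(\cdot),\cdot)-(m+3)\,\epsilon\,\mathbf H=0,$$ where $\mathrm{trace}_g(\nabla A_{\mathbf H})=\sum_i(\nabla_{e_i}A_{\mathbf H})(e_i)$ and $\mathrm{trace}_g(A_{\nabla^\perp_{\cdot}\mathbf H}(\cdot))=\sum_i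 A_{\nabla^\perp_{e_i}\mathbf H}(e_i)$. -/

import Mathlib

open Bundle Manifold
open scoped ContDiff

/-! Riemannian geometry of maps. Throughout, a vector field along a map `φ : M → N` is a function
`V` with `V x ∈ T_{φ x} N`, and first derivatives of vector fields are computed in the preferred
chart at the point at which the derivative is taken. -/

namespace RiemGeom

noncomputable section

variable
  {E : Type*} [NormedAddCommGroup E] [NormedSpace ℝ E]
  {H : Type*} [TopologicalSpace H] (I : ModelWithCorners ℝ E H)
  {M : Type*} [TopologicalSpace M] [ChartedSpace H M] [IsManifold I ∞ M]
  {E' : Type*} [NormedAddCommGroup E'] [NormedSpace ℝ E']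
  {H' : Type*} [TopologicalSpace H'] (I' : ModelWithCorners ℝ E' H')
  {N : Type*} [TopologicalSpace N] [ChartedSpace H' N] [IsManifold I' ∞ N]

instance finiteDimensional_tangentSpace [FiniteDimensional ℝ E] (x : M) :
    FiniteDimensional ℝ (TangentSpace I x) := inferInstanceAs (FiniteDimensional ℝ E)

/-- The coordinate vector field extending `v ∈ T_p M`: near `p`, the vector field whose components
in the preferred chart at `p` are constant, with value `v` at `p`. -/
def coordField {p : M} (v : TangentSpace I p) (q : M) : TangentSpace I q :=
  FiberBundle.extend E v q

section Metric

variable [FiniteDimensional ℝ E] [RiemannianBundle (fun x : M ↦ TangentSpace I x)]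
variable [FiniteDimensional ℝ E'] [RiemannianBundle (fun y : N ↦ TangentSpace I' y)]

/-- The trace with respect to the metric at `x`: `∑ i, T (e i) (e i)` for an orthonormal basis `e`
of `T_x M`. It is applied to bilinear `T` only, so it does not depend on `e`. -/
def metricTrace (x : M) {F : Type*} [AddCommMonoid F]
    (T : TangentSpace I x → TangentSpace I x → F) : F :=
  ∑ i, T (stdOrthonormalBasis ℝ (TangentSpace I x) i) (stdOrthonormalBasis ℝ (TangentSpace I x) i)

/-- The Christoffel symbols at `p` in the preferred chart at `p`, as a bilinear map: for the
coordinate fields `U`, `V`, `W` extending `u`, `v`, `w`,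
`⟨Γ(u, v), w⟩ = (u⟨V, W⟩ + v⟨U, W⟩ - w⟨U, V⟩) / 2`. -/
def christoffel (p : M) (u v : TangentSpace I p) : TangentSpace I p :=
  metricTrace I p fun w w' ↦
    ((mvfderiv I (fun q ↦ inner ℝ (coordField I v q) (coordField I w q)) p u
      + mvfderiv I (fun q ↦ inner ℝ (coordField I u q) (coordField I w q)) p v
      - mvfderiv I (fun q ↦ inner ℝ (coordField I u q) (coordField I v q)) p w) / 2) • w'

/-- The Levi-Civita connection `(∇_v V)(x)`, by the classical formula `v(V^k) + Γ^k_{ij} v^i V^j` in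
the preferred chart at `x`. -/
def leviCivita (V : (x : M) → TangentSpace I x) (x : M) (v : TangentSpace I x) :
    TangentSpace I x :=
  (trivializationAt E (TangentSpace I) x).symmL ℝ x
      (mvfderiv I (fun y ↦ (trivializationAt E (TangentSpace I) x ⟨y, V y⟩).2) x v)
    + christoffel I x v (V x)

/-- The curvature tensor `R(u, v)w = ∇_U ∇_V W - ∇_V ∇_U W - ∇_{[U, V]} W` of the Levi-Civita
connection, computed with the coordinate fields extending `u`, `v`, `w`. -/
def curvature (p : M) (u v w : TangentSpace I p) : TangentSpace I p :=
  leviCivita I (fun q ↦ leviCivita I (coordField I w) q (coordField I v q)) p u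
    - leviCivita I (fun q ↦ leviCivita I (coordField I w) q (coordField I u q)) p v
    - leviCivita I (coordField I w) p
        (VectorField.mlieBracket I (coordField I u) (coordField I v) p)

/-- The sectional curvature of the plane spanned by two linearly independent vectors. -/
def sectionalCurvature (p : M) (u v : TangentSpace I p) : ℝ :=
  inner ℝ (curvature I p u v v) u / (‖u‖ ^ 2 * ‖v‖ ^ 2 - inner ℝ u v ^ 2)

/-- The induced connection `(∇̄_v V)(x)` on the pull-back bundle `φ⁻¹TN`, where `V` is a vector
field along `φ`: in the preferred chart of `N` at `φ x` it is `v(V^k) + Γ^k_{ij} dφ(v)^i V^j`. -/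
def covAlong (φ : M → N) (V : (x : M) → TangentSpace I' (φ x)) (x : M) (v : TangentSpace I x) :
    TangentSpace I' (φ x) :=
  (trivializationAt E' (TangentSpace I') (φ x)).symmL ℝ (φ x)
      (mvfderiv I (fun y ↦ (trivializationAt E' (TangentSpace I') (φ x) ⟨φ y, V y⟩).2) x v)
    + christoffel I' (φ x) (mfderiv I I' φ x v) (V x)

/-- The second fundamental form of a map, `(∇dφ)(X, Y) = ∇̄_X (dφ Y) - dφ(∇_X Y)`. For an
isometric immersion this is the second fundamental form `B` of the Gauss formula
`∇̄_X (dφ Y) = dφ(∇_X Y) + B(X, Y)`. -/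
def secondFundForm (φ : M → N) (x : M) (u v : TangentSpace I x) : TangentSpace I' (φ x) :=
  covAlong I I' φ (fun y ↦ mfderiv I I' φ y (coordField I v y)) x u
    - mfderiv I I' φ x (leviCivita I (coordField I v) x u)

/-- The tension field `τ(φ) = trace ∇dφ`. -/
def tensionField (φ : M → N) (x : M) : TangentSpace I' (φ x) :=
  metricTrace I x (secondFundForm I I' φ x)

/-- The rough Laplacian on vector fields along `φ`,
`Δ̄ V = -∑ (∇̄_{e_k} ∇̄_{e_k} V - ∇̄_{∇_{e_k} e_k} V)`. -/
def roughLaplacian (φ : M → N) (V : (x : M) → TangentSpace I' (φ x)) (x : M) :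
    TangentSpace I' (φ x) :=
  -metricTrace I x fun u v ↦
    covAlong I I' φ (fun y ↦ covAlong I I' φ V y (coordField I v y)) x u
      - covAlong I I' φ V x (leviCivita I (coordField I v) x u)

/-- The bitension field `τ₂(φ) = Δ̄ τ(φ) - ∑ R^N(τ(φ), dφ e_i) dφ e_i`. -/
def bitensionField (φ : M → N) (x : M) : TangentSpace I' (φ x) :=
  roughLaplacian I I' φ (tensionField I I' φ) x
    - metricTrace I x fun u v ↦
        curvature I' (φ x) (tensionField I I' φ x) (mfderiv I I' φ x u) (mfderiv I I' φ x v)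

/-- A map is biharmonic if its bitension field vanishes identically. -/
def IsBiharmonic (φ : M → N) : Prop := ∀ x : M, bitensionField I I' φ x = 0

/-- Smooth isometric immersions: smooth maps with `φ^*⟨·,·⟩ = g`. -/
structure IsIsometricImmersion (φ : M → N) : Prop where
  contMDiff : ContMDiff I I' ∞ φ
  inner_mfderiv : ∀ (x : M) (u v : TangentSpace I x),
    inner ℝ (mfderiv I I' φ x u) (mfderiv I I' φ x v) = inner ℝ u v

/-- The tangential part of `w ∈ T_{φ x} N`, as a vector in `T_x M`: the vector `∑ ⟨w, dφ e_i⟩ e_i`.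
For an isometric immersion, its image under `dφ` is the orthogonal projection of `w`. -/
def tangentPart (φ : M → N) (x : M) (w : TangentSpace I' (φ x)) : TangentSpace I x :=
  metricTrace I x fun u v ↦ (inner ℝ w (mfderiv I I' φ x u) : ℝ) • v

/-- The normal part of `w ∈ T_{φ x} N`. -/
def normalPart (φ : M → N) (x : M) (w : TangentSpace I' (φ x)) : TangentSpace I' (φ x) :=
  w - mfderiv I I' φ x (tangentPart I I' φ x w)

/-- The mean curvature vector field: the trace of `B` divided by the dimension of `M`. -/
def meanCurvature (φ : M → N) (x : M) : TangentSpace I' (φ x) :=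
  (Module.finrank ℝ E : ℝ)⁻¹ • metricTrace I x (secondFundForm I I' φ x)

/-- The shape operator `A_ξ v` of a normal vector field `ξ`, from the Weingarten formula
`∇̄_v ξ = -dφ(A_ξ v) + ∇^⊥_v ξ`. -/
def shapeOperator (φ : M → N) (ξ : (x : M) → TangentSpace I' (φ x)) (x : M)
    (v : TangentSpace I x) : TangentSpace I x :=
  -tangentPart I I' φ x (covAlong I I' φ ξ x v)

/-- The normal connection `∇^⊥_v ξ`. -/
def normalConnection (φ : M → N) (ξ : (x : M) → TangentSpace I' (φ x)) (x : M)
    (v : TangentSpace I x) : TangentSpace I' (φ x) :=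
  normalPart I I' φ x (covAlong I I' φ ξ x v)

/-- The Laplacian of the normal connection,
`Δ^⊥ ξ = -∑ (∇^⊥_{e_i} ∇^⊥_{e_i} ξ - ∇^⊥_{∇_{e_i} e_i} ξ)`. -/
def normalLaplacian (φ : M → N) (ξ : (x : M) → TangentSpace I' (φ x)) (x : M) :
    TangentSpace I' (φ x) :=
  -metricTrace I x fun u v ↦
    normalConnection I I' φ (fun y ↦ normalConnection I I' φ ξ y (coordField I v y)) x u
      - normalConnection I I' φ ξ x (leviCivita I (coordField I v) x u)

/-- `(∇_u A_ξ) v = ∇_u (A_ξ v) - A_ξ (∇_u v)`. -/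
def covShapeOperator (φ : M → N) (ξ : (x : M) → TangentSpace I' (φ x)) (x : M)
    (u v : TangentSpace I x) : TangentSpace I x :=
  leviCivita I (fun y ↦ shapeOperator I I' φ ξ y (coordField I v y)) x u
    - shapeOperator I I' φ ξ x (leviCivita I (coordField I v) x u)

/-- `A_{∇^⊥_u ξ} v`. -/
def shapeNormalDeriv (φ : M → N) (ξ : (x : M) → TangentSpace I' (φ x)) (x : M)
    (u v : TangentSpace I x) : TangentSpace I x :=
  shapeOperator I I' φ (fun y ↦ normalConnection I I' φ ξ y (coordField I u y)) x v

end Metric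

section Kaehler

variable [FiniteDimensional ℝ E] [RiemannianBundle (fun x : M ↦ TangentSpace I x)]

/-- The fundamental 2-form `Φ(U, V) = ⟨U, J V⟩`. -/
def fundamentalForm (J : (p : M) → TangentSpace I p →L[ℝ] TangentSpace I p) (p : M)
    (u v : TangentSpace I p) : ℝ :=
  inner ℝ u (J p v)

/-- The exterior derivative `dΦ(u, v, w) = u Φ(V, W) + v Φ(W, U) + w Φ(U, V)`, with `U`, `V`, `W`
the coordinate fields extending `u`, `v`, `w` (whose brackets vanish). -/
def dFundamentalForm (J : (p : M) → TangentSpace I p →L[ℝ] TangentSpace I p) (p : M)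
    (u v w : TangentSpace I p) : ℝ :=
  mvfderiv I (fun q ↦ fundamentalForm I J q (coordField I v q) (coordField I w q)) p u
    + mvfderiv I (fun q ↦ fundamentalForm I J q (coordField I w q) (coordField I u q)) p v
    + mvfderiv I (fun q ↦ fundamentalForm I J q (coordField I u q) (coordField I v q)) p w

/-- The Nijenhuis tensor `[JU, JV] - J[JU, V] - J[U, JV] - [U, V]`, computed with coordinate
fields. -/
def nijenhuis (J : (p : M) → TangentSpace I p →L[ℝ] TangentSpace I p) (p : M)
    (u v : TangentSpace I p) : TangentSpace I p :=
  VectorField.mlieBracket I (fun q ↦ J q (coordField I u q)) (fun q ↦ J q (coordField I v q)) p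
    - J p (VectorField.mlieBracket I (fun q ↦ J q (coordField I u q)) (coordField I v) p)
    - J p (VectorField.mlieBracket I (coordField I u) (fun q ↦ J q (coordField I v q)) p)
    - VectorField.mlieBracket I (coordField I u) (coordField I v) p

/-- Kähler structures: `J` is a smooth integrable almost complex structure, the metric is
`J`-invariant, and the fundamental 2-form is closed. -/
structure IsKaehler (J : (p : M) → TangentSpace I p →L[ℝ] TangentSpace I p) : Prop where
  contMDiff : ContMDiff I (I.prod 𝓘(ℝ, E →L[ℝ] E)) ∞
    (fun p ↦ TotalSpace.mk' (E →L[ℝ] E)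
      (E := fun p : M ↦ TangentSpace I p →L[ℝ] TangentSpace I p) p (J p))
  sq_eq_neg : ∀ (p : M) (u : TangentSpace I p), J p (J p u) = -u
  integrable : ∀ (p : M) (u v : TangentSpace I p), nijenhuis I J p u v = 0
  inner_map : ∀ (p : M) (u v : TangentSpace I p), inner ℝ (J p u) (J p v) = inner ℝ u v
  closed : ∀ (p : M) (u v w : TangentSpace I p), dFundamentalForm I J p u v w = 0

/-- Complex space forms of constant holomorphic sectional curvature `c`: Kähler manifolds all of
whose holomorphic planes `span {u, J u}` have sectional curvature `c`. -/
structure IsComplexSpaceForm (J : (p : M) → TangentSpace I p →L[ℝ] TangentSpace I p)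
    (c : ℝ) : Prop where
  isKaehler : IsKaehler I J
  sectionalCurvature_eq : ∀ (p : M) (u : TangentSpace I p), u ≠ 0 →
    sectionalCurvature I p u (J p u) = c

end Kaehler

/-- An immersion `φ` of a manifold of half the dimension is Lagrangian if `J` maps each tangent
space `dφ(T_x M)` into its orthogonal complement. -/
def IsLagrangian [RiemannianBundle (fun y : N ↦ TangentSpace I' y)]
    (J : (p : N) → TangentSpace I' p →L[ℝ] TangentSpace I' p) (φ : M → N) : Prop :=
  ∀ (x : M) (u v : TangentSpace I x),
    inner ℝ (J (φ x) (mfderiv I I' φ x u)) (mfderiv I I' φ x v) = 0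

end

end RiemGeom

open RiemGeom

/-! Since the tension field is `m` times the mean curvature `H`, the bitension field is `m` times
`Δ̄H - ∑ R^N(H, dφ e_i) dφ e_i`. Each of the two terms is decomposed along `dφ(TM)` and its
orthogonal complement. As `dφ` is isometric, a sum of a tangential and a normal vector vanishes only
if both do (`mfderiv_add_eq_zero_iff`), which gives the two equations.

For the Laplacian, the Weingarten formula writes `∇̄_v H = ∇^⊥_v H - dφ(A_H v)`, and this is
differentiated again. The normal field contributes `∇^⊥∇^⊥H` and `A_{∇^⊥H}`; the tangential field
contributes, by the Gauss formula, `∇A_H` and `B(A_H v, u)` (`covAlong_covAlong`,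
`roughLaplacian_eq`).

For the curvature, `J` is parallel (`kaehler_parallel`), so `R^N` has the algebraic symmetries of a
Kähler curvature. Subtracting the model tensor with the same holomorphic sectional curvature leaves
a tensor of zero holomorphic curvature, and polarisation kills the entries that occur in the trace
(`IsKaehlerCurvature.eq_zero_of_holomorphic`). In the model, `e_i` and `J e_i` together form an
orthonormal basis of the ambient space, each `i` contributes `ε H + 3 ε ⟨H, J e_i⟩ J e_i`, and the
sum is `(m + 3) ε H`, with no tangential part.

The analytic work comes from the definitions: at each point they use the preferred chart of that
point and an arbitrarily chosen orthonormal basis. Before a second derivative can be taken, every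
object must be written in one fixed chart by a visibly smooth formula (`tr_covAlong`,
`tr_secondFundForm`, `sum_tr_eq`). The local geometry itself is proved for metrics on open subsets
of a vector space and transported by `isMetricOn_gram`. -/

open scoped Topology

namespace LagrangianGeom

noncomputable section

set_option maxSynthPendingDepth 3
set_option linter.unusedSectionVars false

/-! ### Local Riemannian and Kähler geometry on open subsets of a vector space. -/

section Flat

variable {E : Type*} [NormedAddCommGroup E] [NormedSpace ℝ E]
  {E' : Type*} [NormedAddCommGroup E'] [NormedSpace ℝ E']

/-- A smooth Riemannian metric on an open subset of a vector space. -/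
structure IsMetricOn (G : E → E →L[ℝ] E →L[ℝ] ℝ) (s : Set E) : Prop where
  isOpen : IsOpen s
  contDiffOn : ContDiffOn ℝ ∞ G s
  symm : ∀ z ∈ s, ∀ a b, G z a b = G z b a
  pos : ∀ z ∈ s, ∀ a, a ≠ 0 → 0 < G z a a

/-- The Christoffel form of the first kind. -/
def koszul (G : E → E →L[ℝ] E →L[ℝ] ℝ) (z : E) : E →L[ℝ] E →L[ℝ] E →L[ℝ] ℝ :=
  (2⁻¹ : ℝ) • (fderiv ℝ G z + (fderiv ℝ G z).flip -
    ((ContinuousLinearMap.flipₗᵢ ℝ E E ℝ).toContinuousLinearEquiv.toContinuousLinearMap) ∘L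
      (fderiv ℝ G z).flip)

lemma koszul_apply (G : E → E →L[ℝ] E →L[ℝ] ℝ) (z a b c : E) :
    koszul G z a b c =
      (fderiv ℝ G z a b c + fderiv ℝ G z b a c - fderiv ℝ G z c a b) / 2 := by
  simp [koszul]
  ring

/-- The Christoffel form of the Levi-Civita connection. -/
def chris (G : E → E →L[ℝ] E →L[ℝ] ℝ) (z : E) : E →L[ℝ] E →L[ℝ] E :=
  (ContinuousLinearMap.compL ℝ E (E →L[ℝ] ℝ) E (G z).inverse) ∘L koszul G z

lemma chris_apply (G : E → E →L[ℝ] E →L[ℝ] ℝ) (z a b : E) :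
    chris G z a b = (G z).inverse (koszul G z a b) := rfl

namespace IsMetricOn

variable {G : E → E →L[ℝ] E →L[ℝ] ℝ} {s : Set E} (hG : IsMetricOn G s) {z : E} (hz : z ∈ s)
include hG hz

lemma contDiffAt : ContDiffAt ℝ ∞ G z := hG.contDiffOn.contDiffAt (hG.isOpen.mem_nhds hz)

lemma differentiableAt : DifferentiableAt ℝ G z :=
  (hG.contDiffAt hz).differentiableAt (by simp)

lemma eq_of_forall {a b : E} (h : ∀ c, G z a c = G z b c) : a = b := by
  by_contra hab
  have := hG.pos z hz (a - b) (sub_ne_zero.2 hab)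
  simp [h] at this

lemma fderiv_symm (u a b : E) : fderiv ℝ G z u a b = fderiv ℝ G z u b a := by
  have h1 : (fun w ↦ G w a b) =ᶠ[𝓝 z] fun w ↦ G w b a := by
    filter_upwards [hG.isOpen.mem_nhds hz] with w hw using hG.symm w hw a b
  have key (a b : E) : fderiv ℝ (fun w ↦ G w a b) z u = fderiv ℝ G z u a b := by
    have := (hG.differentiableAt hz).hasFDerivAt.clm_apply (hasFDerivAt_const a z)
    have := this.clm_apply (hasFDerivAt_const b z)
    rw [this.fderiv]; simp
  rw [← key, ← key, h1.fderiv_eq]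

variable [FiniteDimensional ℝ E]

/-- Positivity makes `G z` injective into the dual space, which has the same finite dimension. -/
lemma isInvertible : (G z).IsInvertible := by
  have hinj : Function.Injective (G z : E →ₗ[ℝ] E →L[ℝ] ℝ) := by
    intro a b hab
    exact hG.eq_of_forall hz fun c ↦ by
      have : G z a = G z b := hab
      rw [this]
  have hd : Module.finrank ℝ E = Module.finrank ℝ (E →L[ℝ] ℝ) := by
    rw [← LinearMap.toContinuousLinearMap.finrank_eq (M := E →ₗ[ℝ] ℝ)]
    exact (Subspace.dual_finrank_eq (K := ℝ) (V := E)).symm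
  let e := (LinearEquiv.ofInjectiveOfFinrankEq (G z : E →ₗ[ℝ] E →L[ℝ] ℝ) hinj
    hd).toContinuousLinearEquiv
  exact ⟨e, by ext; rfl⟩

lemma apply_inverse (f : E →L[ℝ] ℝ) (c : E) : G z ((G z).inverse f) c = f c := by
  rw [(hG.isInvertible hz).self_apply_inverse]

lemma apply_chris (a b c : E) : G z (chris G z a b) c =
    (fderiv ℝ G z a b c + fderiv ℝ G z b a c - fderiv ℝ G z c a b) / 2 := by
  rw [chris_apply, hG.apply_inverse hz, koszul_apply]

lemma chris_symm (a b : E) : chris G z a b = chris G z b a := by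
  refine hG.eq_of_forall hz fun c ↦ ?_
  rw [hG.apply_chris hz, hG.apply_chris hz, hG.fderiv_symm hz c a b]
  ring

/-- Compatibility of the Levi-Civita connection with the metric: two instances of the Koszul formula
are added and all but one derivative of `G` cancel. -/
lemma fderiv_eq_chris (u a b : E) :
    fderiv ℝ G z u a b = G z (chris G z u a) b + G z a (chris G z u b) := by
  rw [hG.symm z hz a, hG.apply_chris hz, hG.apply_chris hz, hG.fderiv_symm hz u b a,
    hG.fderiv_symm hz a u b, hG.fderiv_symm hz b u a]
  ring

lemma contDiffAt_inverse : ContDiffAt ℝ ∞ (fun w ↦ (G w).inverse) z :=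
  (hG.isInvertible hz).contDiffAt_map_inverse.comp z (hG.contDiffAt hz)

set_option synthInstance.maxHeartbeats 100000 in
lemma contDiffAt_chris : ContDiffAt ℝ ∞ (chris G) z := by
  have h1 : ContDiffAt ℝ ∞ (fderiv ℝ G) z := (hG.contDiffAt hz).fderiv_right (by simp)
  have h2 : ContDiffAt ℝ ∞ (fun w ↦ (fderiv ℝ G w).flip) z :=
    (ContinuousLinearMap.flipₗᵢ ℝ E E (E →L[ℝ] ℝ)).contDiff.contDiffAt.comp z h1
  have h3 : ContDiffAt ℝ ∞ (koszul G) z :=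
    ((h1.add h2).sub (contDiffAt_const.clm_comp h2)).const_smul _
  exact ((ContinuousLinearMap.compL ℝ E (E →L[ℝ] ℝ) E).contDiff.contDiffAt.comp z
    (hG.contDiffAt_inverse hz)).clm_comp h3

end IsMetricOn

/-- If `Φ` pulls back `G'` to `G`, then `D²Φ(a, b) + Γ'(DΦ a, DΦ b) - DΦ Γ(a, b)` is orthogonal
to the image of `DΦ`. -/
theorem isometric_secondForm_orthogonal [FiniteDimensional ℝ E] [FiniteDimensional ℝ E']
    {G : E → E →L[ℝ] E →L[ℝ] ℝ} {s : Set E} (hG : IsMetricOn G s)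
    {G' : E' → E' →L[ℝ] E' →L[ℝ] ℝ} {s' : Set E'} (hG' : IsMetricOn G' s')
    {Φ : E → E'} {z : E} (hz : z ∈ s) (hΦz : Φ z ∈ s') (hΦ : ContDiffAt ℝ 2 Φ z)
    (h : ∀ᶠ w in 𝓝 z, ∀ a b, G w a b = G' (Φ w) (fderiv ℝ Φ w a) (fderiv ℝ Φ w b))
    (a b c : E) :
    G' (Φ z) (fderiv ℝ (fderiv ℝ Φ) z a b + chris G' (Φ z) (fderiv ℝ Φ z a) (fderiv ℝ Φ z b)
      - fderiv ℝ Φ z (chris G z a b)) (fderiv ℝ Φ z c) = 0 := by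
  have hd : DifferentiableAt ℝ Φ z := hΦ.differentiableAt (by simp)
  have hdd : DifferentiableAt ℝ (fderiv ℝ Φ) z :=
    (hΦ.fderiv_right (m := 1) (by norm_num)).differentiableAt (by simp)
  have hsymm : ∀ u v, fderiv ℝ (fderiv ℝ Φ) z u v = fderiv ℝ (fderiv ℝ Φ) z v u :=
    fun u v ↦ (hΦ.isSymmSndFDerivAt (by simp)) u v
  -- Derivative of the pull-back identity `G = Φ^* G'`, by the product and chain rules.
  have key (u a b : E) : fderiv ℝ G z u a b =
      fderiv ℝ G' (Φ z) (fderiv ℝ Φ z u) (fderiv ℝ Φ z a) (fderiv ℝ Φ z b)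
      + G' (Φ z) (fderiv ℝ (fderiv ℝ Φ) z u a) (fderiv ℝ Φ z b)
      + G' (Φ z) (fderiv ℝ Φ z a) (fderiv ℝ (fderiv ℝ Φ) z u b) := by
    have h1 : HasFDerivAt (fun w ↦ G w a b) _ z :=
      ((hG.differentiableAt hz).hasFDerivAt.clm_apply (hasFDerivAt_const a z)).clm_apply
        (hasFDerivAt_const b z)
    have h2 : HasFDerivAt (fun w ↦ G' (Φ w) (fderiv ℝ Φ w a) (fderiv ℝ Φ w b)) _ z :=
      (((hG'.differentiableAt hΦz).hasFDerivAt.comp z hd.hasFDerivAt).clm_apply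
        (hdd.hasFDerivAt.clm_apply (hasFDerivAt_const a z))).clm_apply
        (hdd.hasFDerivAt.clm_apply (hasFDerivAt_const b z))
    have h3 := h1.unique (h2.congr_of_eventuallyEq (by filter_upwards [h] with w hw using hw a b))
    have h4 := congrArg (fun L : E →L[ℝ] ℝ ↦ L u) h3
    simp at h4
    rw [h4]; ring
  have e1 := hG.apply_chris hz a b c
  have e2 := hG'.apply_chris hΦz (fderiv ℝ Φ z a) (fderiv ℝ Φ z b) (fderiv ℝ Φ z c)
  have e3 := h.self_of_nhds (chris G z a b) c
  -- In the Koszul combination of the three permutations, the symmetry of `D²Φ` makes all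
  -- second-derivative terms cancel except `2 G'(D²Φ(a, b), DΦ c)`.
  rw [key, key, key] at e1
  simp only [map_add, map_sub, add_apply, sub_apply]
  rw [hsymm b a, hsymm c a, hsymm c b] at e1
  rw [hG'.symm _ hΦz (fderiv ℝ Φ z b) (fderiv ℝ (fderiv ℝ Φ) z a c)] at e1
  rw [hG'.symm _ hΦz (fderiv ℝ Φ z a) (fderiv ℝ (fderiv ℝ Φ) z b c)] at e1
  linarith

/-- The curvature form of a Christoffel form. -/
def curv (Γ : E → E →L[ℝ] E →L[ℝ] E) (z u v w : E) : E :=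
  fderiv ℝ Γ z u v w - fderiv ℝ Γ z v u w + Γ z u (Γ z v w) - Γ z v (Γ z u w)

lemma curv_swap (Γ : E → E →L[ℝ] E →L[ℝ] E) (z u v w : E) :
    curv Γ z u v w = - curv Γ z v u w := by
  simp only [curv]; abel

namespace IsMetricOn

variable [FiniteDimensional ℝ E] {G : E → E →L[ℝ] E →L[ℝ] ℝ} {s : Set E}
  (hG : IsMetricOn G s) {z : E} (hz : z ∈ s)
include hG hz

lemma hasFDerivAt_chris : HasFDerivAt (chris G) (fderiv ℝ (chris G) z) z :=
  ((hG.contDiffAt_chris hz).differentiableAt (by simp)).hasFDerivAt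

lemma fderiv_chris_symm (u a b : E) :
    fderiv ℝ (chris G) z u a b = fderiv ℝ (chris G) z u b a := by
  have h (a b : E) : HasFDerivAt (fun w ↦ chris G w a b) _ z :=
    ((hG.hasFDerivAt_chris hz).clm_apply (hasFDerivAt_const a z)).clm_apply
      (hasFDerivAt_const b z)
  have h3 := (h a b).unique ((h b a).congr_of_eventuallyEq (by
    filter_upwards [hG.isOpen.mem_nhds hz] with w hw using hG.chris_symm hw a b))
  simpa using congrArg (fun L : E →L[ℝ] E ↦ L u) h3

/-- Torsion-freeness: for symmetric `Γ` the derivative terms and the quadratic terms cancel in pairs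
over the cyclic sum. -/
lemma curv_bianchi (u v w : E) :
    curv (chris G) z u v w + curv (chris G) z v w u + curv (chris G) z w u v = 0 := by
  simp only [curv]
  rw [hG.fderiv_chris_symm hz u w v, hG.fderiv_chris_symm hz v w u, hG.fderiv_chris_symm hz w v u,
    hG.chris_symm hz w v, hG.chris_symm hz w u, hG.chris_symm hz v u]
  abel

/-- Metric compatibility is differentiated once more; equating the two orders of the second
derivative of `G` leaves exactly the action of the curvature on `G`, which is therefore zero. -/
lemma curv_antisymm (u v a b : E) :
    G z (curv (chris G) z u v a) b + G z a (curv (chris G) z u v b) = 0 := by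
  have h1 (u : E) : (fun w ↦ fderiv ℝ G w u a b) =ᶠ[𝓝 z]
      fun w ↦ G w (chris G w u a) b + G w a (chris G w u b) := by
    filter_upwards [hG.isOpen.mem_nhds hz] with w hw using hG.fderiv_eq_chris hw u a b
  have hd : HasFDerivAt (fderiv ℝ G) (fderiv ℝ (fderiv ℝ G) z) z :=
    (((hG.contDiffAt hz).fderiv_right (m := ∞) (by simp)).differentiableAt (by simp)).hasFDerivAt
  have hsymm := (hG.contDiffAt hz).isSymmSndFDerivAt (by
    simpa using (WithTop.coe_le_coe.2 le_top : ((2 : ℕ∞) : WithTop ℕ∞) ≤ ∞))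
  have hg := (hG.differentiableAt hz).hasFDerivAt
  have hc (u a : E) := (((hG.hasFDerivAt_chris hz).clm_apply (hasFDerivAt_const u z)).clm_apply
      (hasFDerivAt_const a z))
  have key (u v : E) : fderiv ℝ (fderiv ℝ G) z v u a b =
      fderiv ℝ G z v (chris G z u a) b + G z (fderiv ℝ (chris G) z v u a) b
      + (fderiv ℝ G z v a (chris G z u b) + G z a (fderiv ℝ (chris G) z v u b)) := by
    have l := ((hd.clm_apply (hasFDerivAt_const u z)).clm_apply
      (hasFDerivAt_const a z)).clm_apply (hasFDerivAt_const b z)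
    have r := ((hg.clm_apply (hc u a)).clm_apply (hasFDerivAt_const b z)).add
      ((hg.clm_apply (hasFDerivAt_const a z)).clm_apply (hc u b))
    have h := congrArg (fun L : E →L[ℝ] ℝ ↦ L v) (l.unique (r.congr_of_eventuallyEq (h1 u)))
    simp at h
    rw [h]; ring
  have e := key u v
  rw [hsymm v u, key v u] at e
  simp only [hG.fderiv_eq_chris hz] at e
  simp only [curv, map_add, map_sub, add_apply, sub_apply]
  linarith

end IsMetricOn

/-- A parallel endomorphism commutes with the curvature. -/
lemma curv_comm {Γ : E → E →L[ℝ] E →L[ℝ] E} {J : E → E →L[ℝ] E} {z : E}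
    (hΓ : DifferentiableAt ℝ Γ z) (hJ : ContDiffAt ℝ 2 J z)
    (h : ∀ᶠ w in 𝓝 z, ∀ a b, fderiv ℝ J w a b + Γ w a (J w b) = J w (Γ w a b)) (u v b : E) :
    curv Γ z u v (J z b) = J z (curv Γ z u v b) := by
  have hsymm := hJ.isSymmSndFDerivAt (by simp)
  have hd := ((hJ.fderiv_right (m := 1) (by norm_num)).differentiableAt (by simp)).hasFDerivAt
  have hj := (hJ.differentiableAt (by simp)).hasFDerivAt
  -- Derivative of the equation `∇J = 0`. Antisymmetrising in `u`, `v` removes `D²J`, and `h0` then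
  -- eliminates the first derivatives of `J`.
  have key (u v : E) : fderiv ℝ (fderiv ℝ J) z v u b
      + (fderiv ℝ Γ z v u (J z b) + Γ z u (fderiv ℝ J z v b))
      = fderiv ℝ J z v (Γ z u b) + J z (fderiv ℝ Γ z v u b) := by
    have g1 := hΓ.hasFDerivAt.clm_apply (hasFDerivAt_const u z)
    have l := ((hd.clm_apply (hasFDerivAt_const u z)).clm_apply (hasFDerivAt_const b z)).add
      (g1.clm_apply (hj.clm_apply (hasFDerivAt_const b z)))
    have r := hj.clm_apply (g1.clm_apply (hasFDerivAt_const b z))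
    have e := congrArg (fun L : E →L[ℝ] E ↦ L v) (l.unique (r.congr_of_eventuallyEq
      (by filter_upwards [h] with w hw using hw u b)))
    simp at e
    rw [add_comm (fderiv ℝ Γ z v u (J z b)), e, add_comm]
  have h0 (a c : E) : fderiv ℝ J z a c = J z (Γ z a c) - Γ z a (J z c) :=
    eq_sub_of_add_eq (h.self_of_nhds a c)
  have e1 := key u v
  have e2 := key v u
  rw [hsymm v u] at e1
  have e3 : (fderiv ℝ Γ z v u (J z b) + Γ z u (fderiv ℝ J z v b))
      - (fderiv ℝ Γ z u v (J z b) + Γ z v (fderiv ℝ J z u b)) =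
      fderiv ℝ J z v (Γ z u b) + J z (fderiv ℝ Γ z v u b)
      - (fderiv ℝ J z u (Γ z v b) + J z (fderiv ℝ Γ z u v b)) := by
    rw [← e1, ← e2]; abel
  simp only [h0, map_sub] at e3
  simp only [curv, map_sub, map_add]
  rw [← sub_eq_zero] at e3 ⊢
  rw [← neg_eq_zero, ← e3]
  abel

/-- On a Kähler manifold the complex structure is parallel. -/
theorem kaehler_parallel [FiniteDimensional ℝ E] {G : E → E →L[ℝ] E →L[ℝ] ℝ} {s : Set E}
    (hG : IsMetricOn G s) {J : E → E →L[ℝ] E} {z : E} (hz : z ∈ s) (hJ : DifferentiableAt ℝ J z)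
    (hsq : ∀ᶠ w in 𝓝 z, ∀ a, J w (J w a) = -a)
    (hinv : ∀ᶠ w in 𝓝 z, ∀ a b, G w (J w a) (J w b) = G w a b)
    (hclosed : ∀ u v w, fderiv ℝ (fun y ↦ G y v (J y w)) z u + fderiv ℝ (fun y ↦ G y w (J y u)) z v
      + fderiv ℝ (fun y ↦ G y u (J y v)) z w = 0)
    (hint : ∀ u v, (fderiv ℝ J z (J z u) v - fderiv ℝ J z (J z v) u)
      + J z (fderiv ℝ J z v u) - J z (fderiv ℝ J z u v) = 0) (x y : E) :
    fderiv ℝ J z x y + chris G z x (J z y) = J z (chris G z x y) := by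
  have hj := hJ.hasFDerivAt
  have hg := (hG.differentiableAt hz).hasFDerivAt
  set Γ := chris G z with hΓ
  have Gs := hG.symm z hz
  have J2 := hsq.self_of_nhds
  have JG := hinv.self_of_nhds
  have Gsk (a b : E) : G z (J z a) b = - G z a (J z b) := by
    have := JG a (J z b)
    rw [J2] at this
    simp at this
    linarith
  have dG (u a b : E) : fderiv ℝ G z u a b = G z (Γ u a) b + G z a (Γ u b) :=
    hG.fderiv_eq_chris hz u a b
  have dJJ (u a : E) : fderiv ℝ J z u (J z a) = - J z (fderiv ℝ J z u a) := by
    have l := hj.clm_apply (hj.clm_apply (hasFDerivAt_const a z))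
    have := congrArg (fun L : E →L[ℝ] E ↦ L u) (l.unique ((hasFDerivAt_const (-a)
      z).congr_of_eventuallyEq (by filter_upwards [hsq] with w hw using hw a)))
    simp at this
    rw [add_comm] at this
    exact eq_neg_of_add_eq_zero_left this
  have dGJ (u a b : E) : fderiv ℝ (fun y ↦ G y a (J y b)) z u =
      fderiv ℝ G z u a (J z b) + G z a (fderiv ℝ J z u b) := by
    have l := (hg.clm_apply (hasFDerivAt_const a z)).clm_apply
      (hj.clm_apply (hasFDerivAt_const b z))
    rw [l.fderiv]; simp [add_comm]
  have dJsk (u a b : E) : fderiv ℝ (fun y ↦ G y a (J y b)) z u =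
      - fderiv ℝ (fun y ↦ G y b (J y a)) z u := by
    rw [← neg_apply, ← fderiv_fun_neg]
    congr 1
    apply Filter.EventuallyEq.fderiv_eq
    filter_upwards [hsq, hinv, hG.isOpen.mem_nhds hz] with w h1 h2 h3
    have := h2 a (J w b)
    rw [h1] at this
    rw [hG.symm w h3 b, ← this]; simp
  -- `N u a` is `(∇_u J) a`, and `A` is the same tensor with its index lowered. The hypotheses
  -- become linear relations on `A`: skewness, behaviour under `J`, the cyclic identity from `dΦ =
  -- 0`, and the vanishing of the Nijenhuis tensor.
  let N (u a : E) : E := fderiv ℝ J z u a + Γ u (J z a) - J z (Γ u a)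
  let A (u a b : E) : ℝ := G z (N u a) b
  have NJ (u a : E) : N u (J z a) = - J z (N u a) := by
    simp only [N, dJJ, J2, map_sub, map_add, map_neg]; abel
  have Ask (u a b : E) : A u a b = - A u b a := by
    have h := dJsk u a b
    rw [dGJ, dGJ, dG, dG] at h
    simp only [A, N, map_sub, map_add, add_apply, sub_apply, Gsk]
    rw [Gs (fderiv ℝ J z u a), Gs (fderiv ℝ J z u b), Gs (Γ u (J z a)), Gs (Γ u (J z b))]
    linarith
  have AJ (u a b : E) : A u (J z a) b = A u a (J z b) := by
    simp only [A, NJ, map_neg, neg_apply, Gsk, neg_neg]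
  have Acyc (u v w : E) : A u v w + A v w u + A w u v = 0 := by
    have h := hclosed u v w
    have e (u a b : E) : fderiv ℝ (fun y ↦ G y a (J y b)) z u
        = A u b a + G z (Γ u a) (J z b) - G z (Γ u b) (J z a) := by
      rw [dGJ, dG]
      simp only [A, N, map_sub, map_add, add_apply, sub_apply, Gsk]
      rw [Gs (fderiv ℝ J z u b), Gs (Γ u (J z b))]
      ring
    rw [e, e, e] at h
    rw [show Γ v w = Γ w v from hG.chris_symm hz _ _, show Γ w u = Γ u w from
      hG.chris_symm hz _ _, show Γ u v = Γ v u from hG.chris_symm hz _ _] at h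
    linarith [Ask u v w, Ask v w u, Ask w u v]
  have hNij (u v w : E) : A (J z u) v w - A (J z v) u w - A v u (J z w) + A u v (J z w) = 0 := by
    -- In the Nijenhuis tensor ordinary derivatives may be replaced by covariant ones, because the
    -- Christoffel terms cancel by symmetry.
    have h : N (J z u) v - N (J z v) u + J z (N v u) - J z (N u v) = 0 := by
      simp only [N, map_sub, map_add, J2]
      rw [show Γ (J z u) (J z v) = Γ (J z v) (J z u) from hG.chris_symm hz _ _,
        show Γ v u = Γ u v from hG.chris_symm hz _ _,
        show Γ (J z u) v = Γ v (J z u) from hG.chris_symm hz _ _,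
        show Γ (J z v) u = Γ u (J z v) from hG.chris_symm hz _ _]
      rw [← hint u v]
      abel
    have := congrArg (fun a ↦ G z a w) h
    simp only [map_add, map_sub, add_apply, sub_apply, map_zero,
      zero_apply, Gsk] at this
    simp only [A]
    linarith
  -- The combination `c1 - c2 + c3` of the cyclic identity at `(u, v, w)`, at `(u, Jv, Jw)`, and the
  -- Nijenhuis identity at `(v, w, Ju)` reduces to `2 A u v w = 0`.
  have A0 (u v w : E) : A u v w = 0 := by
    have c1 := Acyc u v w
    have c2 := Acyc u (J z v) (J z w)
    have c3 := hNij v w (J z u)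
    have j1 : A u (J z v) (J z w) = - A u v w := by
      rw [AJ, J2]; simp [A]
    have j2 := AJ (J z v) w u
    have j3 := Ask (J z w) v (J z u)
    have j4 := AJ (J z w) u v
    have j5 : A w v (J z (J z u)) = - A w v u := by rw [J2]; simp [A]
    have j6 : A v w (J z (J z u)) = - A v w u := by rw [J2]; simp [A]
    have j7 := Ask w v u
    linarith
  have : N x y = 0 := hG.eq_of_forall hz fun c ↦ by simpa [A] using A0 x y c
  exact sub_eq_zero.1 this

end Flat

/-! ### Kähler curvature algebra: holomorphic curvature and polarisation. -/

/-- Algebraic curvature forms of Kähler type. -/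
structure IsKaehlerCurvature {V : Type*} [AddCommGroup V] (J : V → V)
    (K : V → V → V → V → ℝ) : Prop where
  add : ∀ x x' y z w, K (x + x') y z w = K x y z w + K x' y z w
  swap : ∀ x y z w, K x y z w = - K y x z w
  swap' : ∀ x y z w, K x y z w = - K x y w z
  bianchi : ∀ x y z w, K x y z w + K y z x w + K z x y w = 0
  map_map : ∀ x y z w, K x y (J z) (J w) = K x y z w

namespace IsKaehlerCurvature

variable {V : Type*} [AddCommGroup V] {J : V → V} {K : V → V → V → V → ℝ}
  (hK : IsKaehlerCurvature J K)
include hK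

/-- The classical octahedron argument: the four Bianchi identities are combined using the skewness
in each pair. -/
lemma pair (x y z w : V) : K x y z w = K z w x y := by
  have b1 := hK.bianchi x y z w
  have b2 := hK.bianchi y z w x
  have b3 := hK.bianchi z w x y
  have b4 := hK.bianchi w x y z
  have := hK.swap' x y z w
  have := hK.swap' y z x w
  have := hK.swap' z x y w
  have := hK.swap' z w y x
  have := hK.swap' w y z x
  have := hK.swap' w x z y
  have := hK.swap' x z w y
  have := hK.swap' x y w z
  have := hK.swap' y w x z
  have := hK.swap x z w y
  have := hK.swap y w x z
  have := hK.swap' y z w x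
  have := hK.swap' z w x y
  have := hK.swap' w x y z
  have := hK.swap z x y w
  have := hK.swap z x w y
  have := hK.swap w y z x
  have := hK.swap w y x z
  linarith

lemma map_map_left (x y z w : V) : K (J x) (J y) z w = K x y z w := by
  rw [hK.pair, hK.map_map, hK.pair]

lemma add_second (x y y' z w : V) : K x (y + y') z w = K x y z w + K x y' z w := by
  rw [hK.swap, hK.add, hK.swap x y, hK.swap x y']; ring

lemma add_third (x y z z' w : V) : K x y (z + z') w = K x y z w + K x y z' w := by
  rw [hK.pair, hK.add, hK.pair, hK.pair z']

lemma add_fourth (x y z w w' : V) : K x y z (w + w') = K x y z w + K x y z w' := by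
  rw [hK.swap', hK.add_third, hK.swap' x y z w, hK.swap' x y z w']; ring

lemma neg (x y z w : V) : K (-x) y z w = - K x y z w := by
  have h := hK.add x (-x) y z w
  have h0 := hK.add 0 0 y z w
  simp only [add_neg_cancel, add_zero] at h h0
  linarith

lemma neg_second (x y z w : V) : K x (-y) z w = - K x y z w := by
  rw [hK.swap, hK.neg, hK.swap x y]

lemma neg_third (x y z w : V) : K x y (-z) w = - K x y z w := by
  rw [hK.pair, hK.neg, hK.pair z]

lemma neg_fourth (x y z w : V) : K x y z (-w) = - K x y z w := by
  rw [hK.swap', hK.neg_third, hK.swap' x y z w]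

/-- The holomorphic sectional curvatures determine the sectional curvatures. -/
theorem sectional_eq_zero (hJadd : ∀ x y, J (x + y) = J x + J y) (hJ : ∀ x, J (J x) = -x)
    (h : ∀ x, K x (J x) (J x) x = 0) (x y : V) : K x y y x = 0 := by
  have hJneg (x : V) : J (-x) = - J x := by rw [← hJ x, hJ (J x)]
  -- Adding the hypothesis at `x + y` and `x - y` keeps the six terms of degree two in each
  -- variable. Four of them equal `K x (J y) (J y) x`; the other two equal `K x (J x) (J y) y`,
  -- which Bianchi turns into `K x y y x + K x (J y) (J y) x`.
  have key (x y : V) : 3 * K x (J y) (J y) x + K x y y x = 0 := by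
    have q1 := h (x + y)
    have q2 := h (x + -y)
    have qx := h x
    have qy := h y
    simp only [hJadd, hJneg, hK.add, hK.add_second, hK.add_third, hK.add_fourth, hK.neg,
      hK.neg_second, hK.neg_third, hK.neg_fourth] at q1 q2
    have a1 : K y (J x) (J x) y = K x (J y) (J y) x := by
      rw [← hK.map_map_left, ← hK.map_map, hJ, hK.neg_second, hK.neg_third, hK.swap, hK.swap' x]
      ring
    have a2 : K y (J x) (J y) x = K x (J y) (J y) x := by
      rw [← a1, ← hK.map_map, hJ, hK.neg_third, hK.swap' y (J x) (J x)]
    have a3 : K x (J y) (J x) y = K x (J y) (J y) x := by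
      rw [← hK.map_map, hJ, hK.neg_third, hK.swap' x (J y) (J y)]
    have b1 : K y (J y) (J x) x = K x (J x) (J y) y := by
      rw [hK.pair, hK.swap, hK.swap']; ring
    have c1 := hK.bianchi x (J x) (J y) y
    rw [hK.map_map_left, hK.swap' x y x y, hK.swap (J y) x] at c1
    linarith
  have h1 := key x y
  -- Replacing `y` by `J y` exchanges the two unknowns, so both relations together force them to
  -- vanish.
  have h2 := key x (J y)
  rw [hJ, hK.neg_second, hK.neg_third] at h2
  linarith

/-- Polarisation in the outer pair, in which `K x y y w` is symmetric by `pair`. Equal middle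
arguments suffice for the trace below. -/
theorem eq_zero_of_holomorphic (hJadd : ∀ x y, J (x + y) = J x + J y)
    (hJ : ∀ x, J (J x) = -x) (h : ∀ x, K x (J x) (J x) x = 0) (x y w : V) : K x y y w = 0 := by
  have h0 := hK.sectional_eq_zero hJadd hJ h
  have h1 := h0 (x + w) y
  have h2 := h0 x y
  have h3 := h0 w y
  rw [hK.add, hK.add_fourth, hK.add_fourth] at h1
  have : K w y y x = K x y y w := by rw [hK.pair, hK.swap, hK.swap']; ring
  linarith

end IsKaehlerCurvature

/-! ### The model curvature of a complex space form and its Lagrangian trace. -/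

section ComplexSpaceForm

variable {V : Type*} [NormedAddCommGroup V] [InnerProductSpace ℝ V]

/-- The curvature form of a complex space form. -/
def spaceFormCurvature (J : V →ₗ[ℝ] V) (ε : ℝ) (x y z w : V) : ℝ :=
  ε * (inner ℝ y z * inner ℝ x w - inner ℝ x z * inner ℝ y w + inner ℝ (J y) z * inner ℝ (J x) w
    - inner ℝ (J x) z * inner ℝ (J y) w + 2 * inner ℝ x (J y) * inner ℝ (J z) w)

variable {J : V →ₗ[ℝ] V} (hJ : ∀ x, J (J x) = -x) (hinv : ∀ x y, inner ℝ (J x) (J y) = inner ℝ x y)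
include hJ hinv

lemma inner_map_left (x y : V) : inner ℝ (J x) y = - inner ℝ (J y) x := by
  rw [← hinv, hJ, inner_neg_left, real_inner_comm]

lemma isKaehlerCurvature_spaceForm (ε : ℝ) : IsKaehlerCurvature J (spaceFormCurvature J ε) where
  add x x' y z w := by simp only [spaceFormCurvature, map_add, inner_add_left]; ring
  swap x y z w := by
    simp only [spaceFormCurvature]
    rw [real_inner_comm (J y) x, real_inner_comm (J x) y, inner_map_left hJ hinv y x]
    ring
  swap' x y z w := by
    simp only [spaceFormCurvature]
    rw [inner_map_left hJ hinv w z]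
    ring
  bianchi x y z w := by
    simp only [spaceFormCurvature]
    rw [real_inner_comm (J y) x, real_inner_comm (J z) y, real_inner_comm (J x) z,
      inner_map_left hJ hinv y x, inner_map_left hJ hinv z y, inner_map_left hJ hinv z x,
      real_inner_comm y x, real_inner_comm z y, real_inner_comm z x]
    ring
  map_map x y z w := by
    have e (a b : V) : inner ℝ a (J b) = - inner ℝ (J a) b := by
      rw [real_inner_comm, inner_map_left hJ hinv]
    simp only [spaceFormCurvature, hinv, hJ, inner_neg_left]
    rw [e y z, e x w, e x z, e y w]
    rw [e z w]
    ring

/-- The `e i` and `J (e i)` form an orthonormal basis of `V`. Since `h` is orthogonal to all `e i`,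
Parseval gives `∑ ⟨h, J e_i⟩⟨J e_i, w⟩ = ⟨h, w⟩`; this sum enters with factor 3, besides one `⟨h,
w⟩` for each of the `n` indices. -/
lemma sum_spaceFormCurvature {n : ℕ} [FiniteDimensional ℝ V]
    (hn : Module.finrank ℝ V = 2 * n) {e : Fin n → V}
    (he : Orthonormal ℝ e) (hL : ∀ i j, inner ℝ (J (e i)) (e j) = 0) {h : V}
    (hh : ∀ i, inner ℝ h (e i) = 0) (ε : ℝ) (w : V) :
    ∑ i, spaceFormCurvature J ε h (e i) (e i) w = ((n : ℝ) + 3) * ε * inner ℝ h w := by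
  rw [orthonormal_iff_ite] at he
  have ho : Orthonormal ℝ (Sum.elim e (fun i ↦ J (e i)) : Fin n ⊕ Fin n → V) := by
    rw [orthonormal_iff_ite]
    rintro (i | i) (j | j)
    · simp [he]
    · simpa using (real_inner_comm _ _).trans (hL j i)
    · simp [hL]
    · simp [hinv, he]
  have hcard : Fintype.card (Fin n ⊕ Fin n) = Module.finrank ℝ V := by simp [hn]; ring
  have hb := (OrthonormalBasis.mk ho (ho.linearIndependent.span_eq_top_of_card_eq_finrank'
    hcard).ge).sum_inner_mul_inner h w
  simp only [OrthonormalBasis.coe_mk, Fintype.sum_sum_type, Sum.elim_inl, Sum.elim_inr, hh,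
    zero_mul, Finset.sum_const_zero, zero_add] at hb
  have hterm (i : Fin n) : spaceFormCurvature J ε h (e i) (e i) w =
      ε * inner ℝ h w + 3 * ε * (inner ℝ h (J (e i)) * inner ℝ (J (e i)) w) := by
    simp only [spaceFormCurvature, he, hh, hL, inner_map_left hJ hinv h,
      real_inner_comm h (J (e i))]
    simp
    ring
  simp only [hterm, Finset.sum_add_distrib, ← Finset.mul_sum, hb]
  simp
  ring

/-- The Ricci-type trace over a Lagrangian subspace, evaluated on normal vectors. -/
theorem IsKaehlerCurvature.sum_lagrangian {K : V → V → V → V → ℝ} (hK : IsKaehlerCurvature J K)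
    {ε : ℝ} (hol : ∀ x, K x (J x) (J x) x = 4 * ε * ‖x‖ ^ 4)
    {n : ℕ} [FiniteDimensional ℝ V]
    (hn : Module.finrank ℝ V = 2 * n) {e : Fin n → V}
    (he : Orthonormal ℝ e) (hL : ∀ i j, inner ℝ (J (e i)) (e j) = 0) {h : V}
    (hh : ∀ i, inner ℝ h (e i) = 0) (w : V) :
    ∑ i, K h (e i) (e i) w = ((n : ℝ) + 3) * ε * inner ℝ h w := by
  have h0 := isKaehlerCurvature_spaceForm hJ hinv ε
  -- The defect from the model is again of Kähler type and has zero holomorphic sectional curvature,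
  -- so every summand agrees with that of the model.
  have hD : IsKaehlerCurvature J (fun x y z w ↦ K x y z w - spaceFormCurvature J ε x y z w) :=
    { add := fun x x' y z w ↦ by rw [hK.add, h0.add]; ring
      swap := fun x y z w ↦ by rw [hK.swap, h0.swap]; ring
      swap' := fun x y z w ↦ by rw [hK.swap', h0.swap']; ring
      bianchi := fun x y z w ↦ by linarith [hK.bianchi x y z w, h0.bianchi x y z w]
      map_map := fun x y z w ↦ by rw [hK.map_map, h0.map_map] }
  rw [← sum_spaceFormCurvature hJ hinv hn he hL hh ε w]
  refine Finset.sum_congr rfl fun i _ ↦ ?_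
  refine sub_eq_zero.1 (hD.eq_zero_of_holomorphic (fun x y ↦ map_add J x y) hJ (fun x ↦ ?_) h (e i) w)
  have hxx : inner ℝ (J x) x = 0 := by
    have := inner_map_left hJ hinv x x
    linarith
  rw [hol]
  simp only [spaceFormCurvature, hJ, hinv, inner_neg_left, inner_neg_right, hxx,
    real_inner_comm (J x) x, real_inner_self_eq_norm_sq]
  ring

end ComplexSpaceForm

/-! ### Tangent vectors, maps and derivatives in a fixed chart. -/

section Charts

variable {E : Type*} [NormedAddCommGroup E] [NormedSpace ℝ E]
  {M : Type*} [TopologicalSpace M] [ChartedSpace E M] [IsManifold 𝓘(ℝ, E) ∞ M]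
  {F : Type*} [NormedAddCommGroup F] [NormedSpace ℝ F]

/-- The preferred chart at a point. -/
abbrev ch (p : M) : PartialEquiv M E := extChartAt 𝓘(ℝ, E) p

/-- The components of a tangent vector in the chart at `p`. -/
def tr (p q : M) : TangentSpace 𝓘(ℝ, E) q →L[ℝ] E :=
  (trivializationAt E (TangentSpace 𝓘(ℝ, E)) p).continuousLinearMapAt ℝ q

/-- The tangent vector with given components in the chart at `p`. -/
def trSymm (p q : M) : E →L[ℝ] TangentSpace 𝓘(ℝ, E) q :=
  (trivializationAt E (TangentSpace 𝓘(ℝ, E)) p).symmL ℝ q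

lemma tr_trSymm {p q : M} (h : q ∈ (ch (E := E) p).source) (a : E) : tr p q (trSymm p q a) = a :=
  Trivialization.continuousLinearMapAt_symmL _ (by simpa using h) a

lemma trSymm_tr {p q : M} (h : q ∈ (ch (E := E) p).source) (v : TangentSpace 𝓘(ℝ, E) q) :
    trSymm p q (tr p q v) = v :=
  Trivialization.symmL_continuousLinearMapAt _ (by simpa using h) v

lemma tr_injective {p q : M} (h : q ∈ (ch (E := E) p).source) :
    Function.Injective (tr (E := E) p q) := fun a b hab ↦ by
  rw [← trSymm_tr h a, hab, trSymm_tr h]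

lemma tr_apply {p q : M} (h : q ∈ (ch (E := E) p).source) (v : TangentSpace 𝓘(ℝ, E) q) :
    tr p q v = (trivializationAt E (TangentSpace 𝓘(ℝ, E)) p ⟨q, v⟩).2 :=
  Trivialization.continuousLinearMapAt_apply_of_mem (R := ℝ) _ (by simpa using h) v

lemma tr_eq_mvfderiv {p q : M} (h : q ∈ (ch (E := E) p).source) :
    tr p q = mvfderiv 𝓘(ℝ, E) (ch (E := E) p) q := by
  ext v
  exact DFunLike.congr_fun (TangentBundle.continuousLinearMapAt_trivializationAt
    (I := 𝓘(ℝ, E)) (by simpa using h)) v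

lemma ch_target_open (p : M) : IsOpen (ch (E := E) p).target := isOpen_extChartAt_target p

lemma ch_source_mem {p q : M} (h : q ∈ (ch (E := E) p).source) :
    (ch (E := E) p).source ∈ 𝓝 q := (isOpen_extChartAt_source p).mem_nhds h

/-- The chart is centred at `p` while the derivative is taken at any `q` in its domain; this lets
derivatives at varying points be compared in one chart. -/
lemma mvfderiv_eq_fderiv {p q : M} (h : q ∈ (ch (E := E) p).source) {f : M → F}
    (hf : DifferentiableAt ℝ (f ∘ (ch (E := E) p).symm) (ch (E := E) p q))
    (v : TangentSpace 𝓘(ℝ, E) q) :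
    mvfderiv 𝓘(ℝ, E) f q v =
      fderiv ℝ (f ∘ (ch (E := E) p).symm) (ch (E := E) p q) (tr p q v) := by
  have h1 : MDifferentiableAt 𝓘(ℝ, E) 𝓘(ℝ, E) (ch (E := E) p) q :=
    mdifferentiableAt_extChartAt (by simpa using h)
  have h2 : f =ᶠ[𝓝 q] (f ∘ (ch (E := E) p).symm) ∘ ch (E := E) p := by
    filter_upwards [ch_source_mem h] with y hy
    simp only [Function.comp_apply, (ch (E := E) p).left_inv hy]
  have h3 : mfderiv 𝓘(ℝ, E) 𝓘(ℝ, F) f q = (fderiv ℝ (f ∘ (ch (E := E) p).symm)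
      (ch (E := E) p q)).comp (mfderiv 𝓘(ℝ, E) 𝓘(ℝ, E) (ch (E := E) p) q) := by
    rw [h2.mfderiv_eq, mfderiv_comp q hf.mdifferentiableAt h1, mfderiv_eq_fderiv]
    rfl
  rw [tr_eq_mvfderiv h]
  exact DFunLike.congr_fun h3 v

/-- A map read in the charts at `x` and `p`. -/
def rep {E' : Type*} [NormedAddCommGroup E'] [NormedSpace ℝ E']
    {N : Type*} [TopologicalSpace N] [ChartedSpace E' N] (x : M) (p : N) (φ : M → N) : E → E' :=
  ch (E := E') p ∘ φ ∘ (ch (E := E) x).symm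

section

variable {E' : Type*} [NormedAddCommGroup E'] [NormedSpace ℝ E']
  {N : Type*} [TopologicalSpace N] [ChartedSpace E' N] [IsManifold 𝓘(ℝ, E') ∞ N]
  {φ : M → N} {x : M} {p : N} {y : M}

lemma contDiffAt_rep (hφ : ContMDiff 𝓘(ℝ, E) 𝓘(ℝ, E') ∞ φ)
    (hx : y ∈ (ch (E := E) x).source) (hp : φ y ∈ (ch (E := E') p).source) :
    ContDiffAt ℝ ∞ (rep (E := E) (E' := E') x p φ) (ch (E := E) x y) := by
  rw [← contMDiffAt_iff_contDiffAt]
  have h1 : ContMDiffAt 𝓘(ℝ, E) 𝓘(ℝ, E) ∞ (ch (E := E) x).symm (ch (E := E) x y) :=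
    (contMDiffOn_extChartAt_symm x).contMDiffAt
      ((ch_target_open x).mem_nhds ((ch (E := E) x).map_source hx))
  have h0 : (ch (E := E) x).symm (ch (E := E) x y) = y := (ch (E := E) x).left_inv hx
  have h2 : ContMDiffAt 𝓘(ℝ, E) 𝓘(ℝ, E') ∞ φ ((ch (E := E) x).symm (ch (E := E) x y)) :=
    hφ.contMDiffAt
  have h3 : ContMDiffAt 𝓘(ℝ, E') 𝓘(ℝ, E') ∞ (ch (E := E') p)
      (φ ((ch (E := E) x).symm (ch (E := E) x y))) :=
    contMDiffAt_extChartAt' (by rw [h0]; simpa using hp)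
  exact (h3.comp _ h2).comp _ h1

lemma fderiv_rep (hφ : ContMDiff 𝓘(ℝ, E) 𝓘(ℝ, E') ∞ φ)
    (hx : y ∈ (ch (E := E) x).source) (hp : φ y ∈ (ch (E := E') p).source)
    (v : TangentSpace 𝓘(ℝ, E) y) :
    fderiv ℝ (rep (E := E) (E' := E') x p φ) (ch (E := E) x y) (tr x y v) =
      tr p (φ y) (mfderiv 𝓘(ℝ, E) 𝓘(ℝ, E') φ y v) := by
  have h1 : MDifferentiableAt 𝓘(ℝ, E') 𝓘(ℝ, E') (ch (E := E') p) (φ y) :=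
    mdifferentiableAt_extChartAt (by simpa using hp)
  have h2 : MDifferentiableAt 𝓘(ℝ, E) 𝓘(ℝ, E') φ y := hφ.mdifferentiable (by simp) y
  have h3 := mvfderiv_eq_fderiv (f := ch (E := E') p ∘ φ) hx
    ((contDiffAt_rep hφ hx hp).differentiableAt (by simp)) v
  have h4 := mfderiv_comp y h1 h2
  rw [tr_eq_mvfderiv hp]
  exact h3.symm.trans (DFunLike.congr_fun h4 v)

end

/-- The change of coordinates from the chart at `p` to the chart at `q`. -/
def trans (p q : M) : E → E := rep (E := E) (E' := E) p q (id : M → M)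

section

variable {p q y : M} (hp : y ∈ (ch (E := E) p).source) (hq : y ∈ (ch (E := E) q).source)
include hp hq

lemma contDiffAt_trans : ContDiffAt ℝ ∞ (trans (E := E) p q) (ch (E := E) p y) :=
  contDiffAt_rep contMDiff_id hp hq

lemma fderiv_trans (v : TangentSpace 𝓘(ℝ, E) y) :
    fderiv ℝ (trans (E := E) p q) (ch (E := E) p y) (tr p y v) = tr q y v := by
  rw [trans, fderiv_rep contMDiff_id hp hq]
  exact congrArg (tr q y) (DFunLike.congr_fun (mfderiv_id (I := 𝓘(ℝ, E)) (x := y)) v)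

lemma trans_apply : trans (E := E) p q (ch (E := E) p y) = ch (E := E) q y := by
  simp only [trans, rep, Function.comp_apply, id, (ch (E := E) p).left_inv hp]

end

end Charts

/-! ### The metric in a chart. -/

section Metric

variable {E : Type*} [NormedAddCommGroup E] [NormedSpace ℝ E]
  {M : Type*} [TopologicalSpace M] [ChartedSpace E M] [IsManifold 𝓘(ℝ, E) ∞ M]
  [RiemannianBundle (fun x : M ↦ TangentSpace 𝓘(ℝ, E) x)]

/-- The metric in the chart at `p`. -/
def gram (p : M) (z : E) : E →L[ℝ] E →L[ℝ] ℝ :=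
  (innerSL ℝ (E := TangentSpace 𝓘(ℝ, E) ((ch (E := E) p).symm z))).bilinearComp
    (trSymm p ((ch (E := E) p).symm z)) (trSymm p ((ch (E := E) p).symm z))

lemma gram_apply (p : M) (z a b : E) : gram p z a b =
    inner ℝ (trSymm p ((ch (E := E) p).symm z) a) (trSymm p ((ch (E := E) p).symm z) b) := by
  rfl

lemma gram_tr {p y : M} (hp : y ∈ (ch (E := E) p).source) (u v : TangentSpace 𝓘(ℝ, E) y) :
    gram p (ch (E := E) p y) (tr p y u) (tr p y v) = inner ℝ u v := by
  rw [gram_apply, (ch (E := E) p).left_inv hp, trSymm_tr hp, trSymm_tr hp]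

variable [FiniteDimensional ℝ E] [IsContMDiffRiemannianBundle 𝓘(ℝ, E) ∞ E
      (fun x : M ↦ TangentSpace 𝓘(ℝ, E) x)]

lemma contMDiffAt_trSymm {p y : M} (hp : y ∈ (ch (E := E) p).source) (a : E) :
    ContMDiffAt 𝓘(ℝ, E) (𝓘(ℝ, E).prod 𝓘(ℝ, E)) ∞
      (fun q : M ↦ TotalSpace.mk' E (E := TangentSpace 𝓘(ℝ, E)) q (trSymm p q a)) y := by
  rw [Trivialization.contMDiffAt_section_iff (e := trivializationAt E (TangentSpace 𝓘(ℝ, E)) p)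
    (by simpa using hp)]
  refine (contMDiffAt_const (c := a)).congr_of_eventuallyEq ?_
  filter_upwards [ch_source_mem hp] with q hq
  rw [← tr_apply hq, tr_trSymm hq]

/-- The bridge through which the local theory applies to a manifold. Smoothness is checked on the
entries, which are inner products of smooth sections. -/
lemma isMetricOn_gram (p : M) : IsMetricOn (gram (E := E) p) (ch (E := E) p).target where
  isOpen := ch_target_open p
  symm z _ a b := by rw [gram_apply, gram_apply, real_inner_comm]
  pos z hz a ha := by
    rw [gram_apply]
    refine real_inner_self_pos.2 fun h ↦ ha ?_
    rw [← tr_trSymm ((ch (E := E) p).map_target hz) a, h, map_zero]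
  contDiffOn := by
    rw [contDiffOn_clm_apply]
    intro a
    rw [contDiffOn_clm_apply]
    intro b z hz
    have hs := (ch (E := E) p).map_target hz
    have h1 : ContMDiffAt 𝓘(ℝ, E) 𝓘(ℝ, E) ∞ (ch (E := E) p).symm z :=
      (contMDiffOn_extChartAt_symm p).contMDiffAt ((ch_target_open p).mem_nhds hz)
    have h2 := ContMDiffAt.inner_bundle (F := E) (E := fun x : M ↦ TangentSpace 𝓘(ℝ, E) x)
      (contMDiffAt_trSymm hs a) (contMDiffAt_trSymm hs b)
    exact (contMDiffAt_iff_contDiffAt.1 (h2.comp z h1)).contDiffWithinAt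

end Metric

/-! ### Metric traces and Riesz representation. -/

section Trace

variable {E : Type*} [NormedAddCommGroup E] [NormedSpace ℝ E] [FiniteDimensional ℝ E]
  {M : Type*} [TopologicalSpace M] [ChartedSpace E M] [IsManifold 𝓘(ℝ, E) ∞ M]
  [RiemannianBundle (fun x : M ↦ TangentSpace 𝓘(ℝ, E) x)]

/-- Riesz representation: `∑ L(e_i) e_i` is the vector dual to `L`. Both the Christoffel symbols and
the tangential part are defined by such sums, and this identifies them without reference to the
basis. -/
lemma inner_metricTrace_smul {x : M} {L : TangentSpace 𝓘(ℝ, E) x → ℝ}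
    (hadd : ∀ a b, L (a + b) = L a + L b) (hsmul : ∀ (c : ℝ) a, L (c • a) = c * L a)
    (w : TangentSpace 𝓘(ℝ, E) x) :
    inner ℝ (metricTrace 𝓘(ℝ, E) x fun u v ↦ L u • v) w = L w := by
  let L' : TangentSpace 𝓘(ℝ, E) x →ₗ[ℝ] ℝ := ⟨⟨L, hadd⟩, hsmul⟩
  have h : L' w = ∑ i, L' (inner ℝ (stdOrthonormalBasis ℝ (TangentSpace 𝓘(ℝ, E) x) i) w •
      stdOrthonormalBasis ℝ (TangentSpace 𝓘(ℝ, E) x) i) := by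
    rw [← map_sum, OrthonormalBasis.sum_repr']
  rw [metricTrace, sum_inner]
  refine Eq.trans ?_ h.symm
  refine Finset.sum_congr rfl fun i _ ↦ ?_
  rw [inner_smul_left, map_smul, smul_eq_mul, mul_comm]
  rfl

end Trace

/-! ### Christoffel symbols at the centre of a chart. -/

section Christoffel

variable {E : Type*} [NormedAddCommGroup E] [NormedSpace ℝ E] [FiniteDimensional ℝ E]
  {M : Type*} [TopologicalSpace M] [ChartedSpace E M] [IsManifold 𝓘(ℝ, E) ∞ M]
  [RiemannianBundle (fun x : M ↦ TangentSpace 𝓘(ℝ, E) x)]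
  [IsContMDiffRiemannianBundle 𝓘(ℝ, E) ∞ E (fun x : M ↦ TangentSpace 𝓘(ℝ, E) x)]

lemma mem_ch_source (p : M) : p ∈ (ch (E := E) p).source := mem_extChartAt_source p

lemma coordField_eq {p q : M} (hq : q ∈ (ch (E := E) p).source) (v : TangentSpace 𝓘(ℝ, E) p) :
    coordField 𝓘(ℝ, E) v q = trSymm p q (tr p p v) := by
  rw [tr_apply (mem_ch_source p)]
  exact (Trivialization.symmL_apply (R := ℝ) _ (by simpa using hq) _).symm

@[simp] lemma coordField_self {p : M} (v : TangentSpace 𝓘(ℝ, E) p) :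
    coordField 𝓘(ℝ, E) v p = v := FiberBundle.extend_apply_self E v

lemma ch_mem_target {p q : M} (hq : q ∈ (ch (E := E) p).source) :
    ch (E := E) p q ∈ (ch (E := E) p).target := (ch (E := E) p).map_source hq

lemma mvfderiv_inner_coordField {p : M} (u v w : TangentSpace 𝓘(ℝ, E) p) :
    mvfderiv 𝓘(ℝ, E)
      (fun q ↦ inner ℝ (coordField 𝓘(ℝ, E) v q) (coordField 𝓘(ℝ, E) w q)) p u
      = fderiv ℝ (gram (E := E) p) (ch (E := E) p p) (tr p p u) (tr p p v) (tr p p w) := by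
  have hp := mem_ch_source (E := E) p
  have hd := ((((isMetricOn_gram (E := E) p).differentiableAt (ch_mem_target hp)).hasFDerivAt.clm_apply
    (hasFDerivAt_const (tr p p v) _)).clm_apply (hasFDerivAt_const (tr p p w) _))
  have h1 : (fun q ↦ inner ℝ (coordField 𝓘(ℝ, E) v q) (coordField 𝓘(ℝ, E) w q)) ∘
      (ch (E := E) p).symm =ᶠ[𝓝 (ch (E := E) p p)]
      fun z ↦ gram (E := E) p z (tr p p v) (tr p p w) := by
    filter_upwards [(ch_target_open p).mem_nhds (ch_mem_target hp)] with z hz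
    simp only [Function.comp_apply, gram_apply]
    rw [coordField_eq ((ch (E := E) p).map_target hz), coordField_eq ((ch (E := E) p).map_target hz)]
  have h2 := hd.congr_of_eventuallyEq h1
  rw [mvfderiv_eq_fderiv hp h2.differentiableAt, h2.fderiv]
  simp

lemma inner_christoffel {p : M} (u v w : TangentSpace 𝓘(ℝ, E) p) :
    inner ℝ (christoffel 𝓘(ℝ, E) p u v) w =
      (fderiv ℝ (gram (E := E) p) (ch (E := E) p p) (tr p p u) (tr p p v) (tr p p w)
      + fderiv ℝ (gram (E := E) p) (ch (E := E) p p) (tr p p v) (tr p p u) (tr p p w)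
      - fderiv ℝ (gram (E := E) p) (ch (E := E) p p) (tr p p w) (tr p p u) (tr p p v)) / 2 := by
  simp only [christoffel, mvfderiv_inner_coordField]
  refine inner_metricTrace_smul (L := fun w ↦ _) ?_ ?_ w
  · intro a b
    simp only [map_add, add_apply]; ring
  · intro c a
    simp only [map_smul, smul_apply, smul_eq_mul]; ring

lemma tr_christoffel {p : M} (u v : TangentSpace 𝓘(ℝ, E) p) :
    tr p p (christoffel 𝓘(ℝ, E) p u v) =
      chris (gram (E := E) p) (ch (E := E) p p) (tr p p u) (tr p p v) := by
  have hp := mem_ch_source (E := E) p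
  refine (isMetricOn_gram (E := E) p).eq_of_forall (ch_mem_target hp) fun c ↦ ?_
  rw [(isMetricOn_gram (E := E) p).apply_chris (ch_mem_target hp)]
  conv_lhs => rw [← tr_trSymm hp c, gram_tr hp, inner_christoffel]
  rw [tr_trSymm hp]

end Christoffel

/-! ### Connections in an arbitrary chart. -/

section Along

variable {E : Type*} [NormedAddCommGroup E] [NormedSpace ℝ E] [FiniteDimensional ℝ E]
  {M : Type*} [TopologicalSpace M] [ChartedSpace E M] [IsManifold 𝓘(ℝ, E) ∞ M]
  [RiemannianBundle (fun x : M ↦ TangentSpace 𝓘(ℝ, E) x)]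
  [IsContMDiffRiemannianBundle 𝓘(ℝ, E) ∞ E (fun x : M ↦ TangentSpace 𝓘(ℝ, E) x)]
  {E' : Type*} [NormedAddCommGroup E'] [NormedSpace ℝ E'] [FiniteDimensional ℝ E']
  {N : Type*} [TopologicalSpace N] [ChartedSpace E' N] [IsManifold 𝓘(ℝ, E') ∞ N]
  [RiemannianBundle (fun x : N ↦ TangentSpace 𝓘(ℝ, E') x)]
  [IsContMDiffRiemannianBundle 𝓘(ℝ, E') ∞ E' (fun x : N ↦ TangentSpace 𝓘(ℝ, E') x)]
  {φ : M → N} {x : M} {p : N} {y : M}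

lemma eventually_mem_sources (hφ : ContMDiff 𝓘(ℝ, E) 𝓘(ℝ, E') ∞ φ)
    (hx : y ∈ (ch (E := E) x).source) (hp : φ y ∈ (ch (E := E') p).source) :
    ∀ᶠ z in 𝓝 (ch (E := E) x y), z ∈ (ch (E := E) x).target ∧
      φ ((ch (E := E) x).symm z) ∈ (ch (E := E') p).source := by
  have h1 : ContinuousAt (ch (E := E) x).symm (ch (E := E) x y) :=
    continuousAt_extChartAt_symm' hx
  have h0 : (ch (E := E) x).symm (ch (E := E) x y) = y := (ch (E := E) x).left_inv hx
  have h2 : ContinuousAt (φ ∘ (ch (E := E) x).symm) (ch (E := E) x y) :=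
    hφ.continuous.continuousAt.comp h1
  have h3 : (ch (E := E') p).source ∈ 𝓝 ((φ ∘ (ch (E := E) x).symm) (ch (E := E) x y)) := by
    simp only [Function.comp_apply, h0]
    exact ch_source_mem hp
  exact Filter.Eventually.and ((ch_target_open x).mem_nhds (ch_mem_target hx)) (h2 h3)

lemma gram_rep (hφ : ContMDiff 𝓘(ℝ, E) 𝓘(ℝ, E') ∞ φ)
    (hiso : ∀ (x : M) (u v : TangentSpace 𝓘(ℝ, E) x),
      inner ℝ (mfderiv 𝓘(ℝ, E) 𝓘(ℝ, E') φ x u) (mfderiv 𝓘(ℝ, E) 𝓘(ℝ, E') φ x v) = inner ℝ u v)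
    {z : E} (hz : z ∈ (ch (E := E) x).target)
    (hp : φ ((ch (E := E) x).symm z) ∈ (ch (E := E') p).source) (a b : E) :
    gram x z a b = gram p (rep (E := E) (E' := E') x p φ z)
      (fderiv ℝ (rep (E := E) (E' := E') x p φ) z a)
      (fderiv ℝ (rep (E := E) (E' := E') x p φ) z b) := by
  obtain ⟨y, hy, rfl⟩ : ∃ y ∈ (ch (E := E) x).source, ch (E := E) x y = z :=
    ⟨_, (ch (E := E) x).map_target hz, (ch (E := E) x).right_inv hz⟩
  rw [(ch (E := E) x).left_inv hy] at hp
  rw [← tr_trSymm hy a, ← tr_trSymm hy b, fderiv_rep hφ hy hp, fderiv_rep hφ hy hp, gram_tr hy]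
  have : rep (E := E) (E' := E') x p φ (ch (E := E) x y) = ch (E := E') p (φ y) := by
    simp only [rep, Function.comp_apply, (ch (E := E) x).left_inv hy]
  rw [this, gram_tr hp, hiso]

/-- The components of a vector field along `φ`, in the charts at `x` and `p`. -/
def fld (x : M) (p : N) (φ : M → N) (V : (y : M) → TangentSpace 𝓘(ℝ, E') (φ y)) (z : E) : E' :=
  tr p (φ ((ch (E := E) x).symm z)) (V ((ch (E := E) x).symm z))

lemma fld_ch (V : (y : M) → TangentSpace 𝓘(ℝ, E') (φ y)) (hx : y ∈ (ch (E := E) x).source) :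
    fld (E := E) x p φ V (ch (E := E) x y) = tr p (φ y) (V y) := by
  rw [fld, (ch (E := E) x).left_inv hx]

/-- The transformation law of the Christoffel symbols. -/
lemma fderiv_trans_chris {p q y : M} (hp : y ∈ (ch (E := E) p).source)
    (hq : y ∈ (ch (E := E) q).source) (a b : E) :
    fderiv ℝ (trans (E := E) p q) (ch (E := E) p y)
      (chris (gram (E := E) p) (ch (E := E) p y) a b) =
    fderiv ℝ (fderiv ℝ (trans (E := E) p q)) (ch (E := E) p y) a b
      + chris (gram (E := E) q) (ch (E := E) q y)
        (fderiv ℝ (trans (E := E) p q) (ch (E := E) p y) a)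
        (fderiv ℝ (trans (E := E) p q) (ch (E := E) p y) b) := by
  have hiso : ∀ (x : M) (u v : TangentSpace 𝓘(ℝ, E) x),
      inner ℝ (mfderiv 𝓘(ℝ, E) 𝓘(ℝ, E) (id : M → M) x u)
        (mfderiv 𝓘(ℝ, E) 𝓘(ℝ, E) (id : M → M) x v) = inner ℝ u v := by
    intro x u v
    rw [mfderiv_id]
    rfl
  have ht := trans_apply hp hq
  -- A coordinate change is an isometry between the two local metrics, and its differential is onto;
  -- a vector orthogonal to the image is zero.
  have key := isometric_secondForm_orthogonal (isMetricOn_gram (E := E) p)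
    (isMetricOn_gram (E := E) q) (Φ := trans (E := E) p q) (ch_mem_target hp)
    (by rw [ht]; exact ch_mem_target hq)
    ((contDiffAt_trans hp hq).of_le (WithTop.coe_le_coe.2 le_top))
    (by
      filter_upwards [eventually_mem_sources (φ := id) contMDiff_id hp hq] with z hz a b
      exact gram_rep contMDiff_id hiso hz.1 hz.2 a b) a b
  rw [ht] at key
  refine (sub_eq_zero.1 ((isMetricOn_gram (E := E) q).eq_of_forall (ch_mem_target hq)
    fun c ↦ ?_)).symm
  have := key (tr p y (trSymm q y c))
  rw [fderiv_trans hp hq, tr_trSymm hq] at this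
  rw [this]; simp

/-- The induced connection in the charts at `x` and `p`. -/
theorem tr_covAlong (hφ : ContMDiff 𝓘(ℝ, E) 𝓘(ℝ, E') ∞ φ)
    (hx : y ∈ (ch (E := E) x).source) (hp : φ y ∈ (ch (E := E') p).source)
    {V : (y : M) → TangentSpace 𝓘(ℝ, E') (φ y)}
    (hV : DifferentiableAt ℝ (fld (E := E) x p φ V) (ch (E := E) x y))
    (v : TangentSpace 𝓘(ℝ, E) y) :
    tr p (φ y) (covAlong 𝓘(ℝ, E) 𝓘(ℝ, E') φ V y v) =
      fderiv ℝ (fld (E := E) x p φ V) (ch (E := E) x y) (tr x y v)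
      + chris (gram (E := E') p) (ch (E := E') p (φ y))
        (tr p (φ y) (mfderiv 𝓘(ℝ, E) 𝓘(ℝ, E') φ y v)) (tr p (φ y) (V y)) := by
  have hq := mem_ch_source (E := E') (φ y)
  have hrep : rep (E := E) (E' := E') x p φ (ch (E := E) x y) = ch (E := E') p (φ y) := by
    simp only [rep, Function.comp_apply, (ch (E := E) x).left_inv hx]
  -- The definition of `covAlong` at `y` uses the chart at `φ y`; `θ` leads there from the fixed
  -- chart at `p`.
  set θ := trans (E := E') p (φ y) with hθ
  have hD : ∀ w : TangentSpace 𝓘(ℝ, E') (φ y),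
      fderiv ℝ θ (ch (E := E') p (φ y)) (tr p (φ y) w) = tr (φ y) (φ y) w :=
    fun w ↦ fderiv_trans hp hq w
  have hθ2 : HasFDerivAt (fderiv ℝ θ) (fderiv ℝ (fderiv ℝ θ) (ch (E := E') p (φ y)))
      (rep (E := E) (E' := E') x p φ (ch (E := E) x y)) := by
    rw [hrep]
    exact (((contDiffAt_trans hp hq).fderiv_right (m := 1)
      (WithTop.coe_le_coe.2 le_top)).differentiableAt (by simp)).hasFDerivAt
  have hr := ((contDiffAt_rep hφ hx hp).differentiableAt (by simp)).hasFDerivAt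
  have hd := (hθ2.comp _ hr).clm_apply hV.hasFDerivAt
  have heq : (fun y' ↦ (trivializationAt E' (TangentSpace 𝓘(ℝ, E')) (φ y) ⟨φ y', V y'⟩).2) ∘
      (ch (E := E) x).symm =ᶠ[𝓝 (ch (E := E) x y)]
      fun z ↦ (fderiv ℝ θ ∘ rep (E := E) (E' := E') x p φ) z (fld (E := E) x p φ V z) := by
    filter_upwards [eventually_mem_sources hφ hx hp, eventually_mem_sources hφ hx hq] with z h1 h2
    simp only [Function.comp_apply, fld, rep]
    rw [← tr_apply h2.2, hθ, fderiv_trans h1.2 h2.2]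
  have hd' := hd.congr_of_eventuallyEq heq
  have hmain : tr (φ y) (φ y) (covAlong 𝓘(ℝ, E) 𝓘(ℝ, E') φ V y v) =
      fderiv ℝ (fderiv ℝ θ) (ch (E := E') p (φ y))
        (fderiv ℝ (rep (E := E) (E' := E') x p φ) (ch (E := E) x y) (tr x y v))
        (tr p (φ y) (V y))
      + fderiv ℝ θ (ch (E := E') p (φ y))
        (fderiv ℝ (fld (E := E) x p φ V) (ch (E := E) x y) (tr x y v))
      + chris (gram (E := E') (φ y)) (ch (E := E') (φ y) (φ y))
        (tr (φ y) (φ y) (mfderiv 𝓘(ℝ, E) 𝓘(ℝ, E') φ y v)) (tr (φ y) (φ y) (V y)) := by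
    rw [covAlong, map_add, tr_christoffel, mvfderiv_eq_fderiv hx hd'.differentiableAt, hd'.fderiv]
    congr 1
    refine (tr_trSymm hq _).trans ?_
    simp only [add_apply, ContinuousLinearMap.comp_apply, ContinuousLinearMap.flip_apply,
      Function.comp_apply, hrep, fld_ch V hx]
    exact add_comm _ _
  set R := fderiv ℝ (fld (E := E) x p φ V) (ch (E := E) x y) (tr x y v)
      + chris (gram (E := E') p) (ch (E := E') p (φ y))
        (tr p (φ y) (mfderiv 𝓘(ℝ, E) 𝓘(ℝ, E') φ y v)) (tr p (φ y) (V y)) with hR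
  -- The `D²θ` term produced by the product rule is the inhomogeneous term in the transformation law
  -- of the Christoffel symbols.
  have : covAlong 𝓘(ℝ, E) 𝓘(ℝ, E') φ V y v = trSymm p (φ y) R := by
    apply tr_injective hq
    rw [hmain, ← hD (trSymm p (φ y) R), tr_trSymm hp, hR, map_add, fderiv_trans_chris hp hq,
      fderiv_rep hφ hx hp]
    rw [← hθ, hD, hD]
    abel
  rw [this, tr_trSymm hp]

/-- Makes the Levi-Civita connection a special case, so that chart independence is proved only once.
-/
lemma leviCivita_eq_covAlong (V : (y : M) → TangentSpace 𝓘(ℝ, E) y) (y : M)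
    (v : TangentSpace 𝓘(ℝ, E) y) :
    leviCivita 𝓘(ℝ, E) V y v = covAlong 𝓘(ℝ, E) 𝓘(ℝ, E) (id : M → M) V y v := by
  simp only [leviCivita, covAlong]
  rw [mfderiv_id]
  rfl

/-- The Levi-Civita connection in the chart at `x`. -/
theorem tr_leviCivita (hx : y ∈ (ch (E := E) x).source)
    {V : (y : M) → TangentSpace 𝓘(ℝ, E) y}
    (hV : DifferentiableAt ℝ (fld (E := E) x x id V) (ch (E := E) x y))
    (v : TangentSpace 𝓘(ℝ, E) y) :
    tr x y (leviCivita 𝓘(ℝ, E) V y v) =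
      fderiv ℝ (fld (E := E) x x id V) (ch (E := E) x y) (tr x y v)
      + chris (gram (E := E) x) (ch (E := E) x y) (tr x y v) (tr x y (V y)) := by
  rw [leviCivita_eq_covAlong]
  have h := tr_covAlong (φ := (id : M → M)) contMDiff_id hx hx hV v
  rw [mfderiv_id] at h
  exact h

end Along

/-! ### Smooth fields along a map and their covariant derivatives. -/

section

variable {E : Type*} [NormedAddCommGroup E] [NormedSpace ℝ E] [FiniteDimensional ℝ E]
  {M : Type*} [TopologicalSpace M] [ChartedSpace E M] [IsManifold 𝓘(ℝ, E) ∞ M]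
  [RiemannianBundle (fun x : M ↦ TangentSpace 𝓘(ℝ, E) x)]
  [IsContMDiffRiemannianBundle 𝓘(ℝ, E) ∞ E (fun x : M ↦ TangentSpace 𝓘(ℝ, E) x)]
  {E' : Type*} [NormedAddCommGroup E'] [NormedSpace ℝ E'] [FiniteDimensional ℝ E']
  {N : Type*} [TopologicalSpace N] [ChartedSpace E' N] [IsManifold 𝓘(ℝ, E') ∞ N]
  [RiemannianBundle (fun x : N ↦ TangentSpace 𝓘(ℝ, E') x)]
  [IsContMDiffRiemannianBundle 𝓘(ℝ, E') ∞ E' (fun x : N ↦ TangentSpace 𝓘(ℝ, E') x)]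
  {φ : M → N} {x : M}

/-- Smoothness at `x` of a vector field along `φ`. -/
def SmoothAlongAt (φ : M → N) (V : (y : M) → TangentSpace 𝓘(ℝ, E') (φ y)) (x : M) : Prop :=
  ContDiffAt ℝ ∞ (fld (E := E) x (φ x) φ V) (ch (E := E) x x)

lemma _root_.ContDiffAt.eventually_differentiableAt {f : E → E'} {z : E}
    (hf : ContDiffAt ℝ ∞ f z) : ∀ᶠ w in 𝓝 z, DifferentiableAt ℝ f w := by
  filter_upwards [(hf.of_le (m := 1) (WithTop.coe_le_coe.2 le_top)).eventually (by simp)] with w hw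
  exact hw.differentiableAt (by simp)

/-- Points near `ch x x`, as images of points near `x` at which all the charts are defined. -/
lemma eventually_ch (hφ : ContMDiff 𝓘(ℝ, E) 𝓘(ℝ, E') ∞ φ) {P : E → Prop}
    (h : ∀ᶠ z in 𝓝 (ch (E := E) x x), (∃ y ∈ (ch (E := E) x).source,
      φ y ∈ (ch (E := E') (φ x)).source ∧ z = ch (E := E) x y) → P z) :
    ∀ᶠ z in 𝓝 (ch (E := E) x x), P z := by
  filter_upwards [h, eventually_mem_sources hφ (mem_ch_source (E := E) x)
    (mem_ch_source (E := E') (φ x))] with z h1 h2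
  exact h1 ⟨_, (ch (E := E) x).map_target h2.1, h2.2, ((ch (E := E) x).right_inv h2.1).symm⟩

lemma rep_ch {p : N} {y : M} (hx : y ∈ (ch (E := E) x).source) :
    rep (E := E) (E' := E') x p φ (ch (E := E) x y) = ch (E := E') p (φ y) := by
  simp only [rep, Function.comp_apply, (ch (E := E) x).left_inv hx]

/-- An equality of germs and not only of values at `x`: the right-hand side is built from smooth
maps, so the derivative field can be differentiated again. -/
lemma fld_covAlong (hφ : ContMDiff 𝓘(ℝ, E) 𝓘(ℝ, E') ∞ φ)
    {V : (y : M) → TangentSpace 𝓘(ℝ, E') (φ y)} (hV : SmoothAlongAt (E := E) φ V x)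
    (X : (y : M) → TangentSpace 𝓘(ℝ, E) y) :
    fld (E := E) x (φ x) φ (fun y ↦ covAlong 𝓘(ℝ, E) 𝓘(ℝ, E') φ V y (X y))
      =ᶠ[𝓝 (ch (E := E) x x)] fun z ↦ fderiv ℝ (fld (E := E) x (φ x) φ V) z (fld x x id X z)
        + chris (gram (E := E') (φ x)) (rep (E := E) (E' := E') x (φ x) φ z)
          (fderiv ℝ (rep (E := E) (E' := E') x (φ x) φ) z (fld x x id X z))
          (fld (E := E) x (φ x) φ V z) := by
  apply eventually_ch hφ
  filter_upwards [hV.eventually_differentiableAt]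
  rintro _ hd ⟨y, hy, hp, rfl⟩
  rw [fld_ch _ hy, tr_covAlong hφ hy hp hd, fld_ch _ hy, fld_ch _ hy, rep_ch hy]
  congr 3
  exact (fderiv_rep hφ hy hp _).symm

lemma fld_mfderiv (hφ : ContMDiff 𝓘(ℝ, E) 𝓘(ℝ, E') ∞ φ)
    (X : (y : M) → TangentSpace 𝓘(ℝ, E) y) :
    fld (E := E) x (φ x) φ (fun y ↦ mfderiv 𝓘(ℝ, E) 𝓘(ℝ, E') φ y (X y))
      =ᶠ[𝓝 (ch (E := E) x x)]
        fun z ↦ fderiv ℝ (rep (E := E) (E' := E') x (φ x) φ) z (fld x x id X z) := by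
  apply eventually_ch hφ
  refine .of_forall ?_
  rintro _ ⟨y, hy, hp, rfl⟩
  beta_reduce
  rw [fld_ch _ hy, fld_ch _ hy]
  exact (fderiv_rep hφ hy hp _).symm

lemma inner_tangentPart (y : M) (w : TangentSpace 𝓘(ℝ, E') (φ y)) (c : TangentSpace 𝓘(ℝ, E) y) :
    inner ℝ (tangentPart 𝓘(ℝ, E) 𝓘(ℝ, E') φ y w) c =
      inner ℝ w (mfderiv 𝓘(ℝ, E) 𝓘(ℝ, E') φ y c) := by
  rw [tangentPart, inner_metricTrace_smul
    (L := fun u ↦ inner ℝ w (mfderiv 𝓘(ℝ, E) 𝓘(ℝ, E') φ y u))]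
  · intro a b
    rw [map_add, inner_add_right]
  · intro c a
    rw [map_smul, inner_smul_right]

/-- The covector `G'(V, DΦ ·)` with its index raised by `G⁻¹`. The orthonormal bases, which need not
vary continuously, have disappeared, so smoothness can be read off. -/
lemma fld_tangentPart (hφ : ContMDiff 𝓘(ℝ, E) 𝓘(ℝ, E') ∞ φ)
    (V : (y : M) → TangentSpace 𝓘(ℝ, E') (φ y)) :
    fld (E := E) x x id (fun y ↦ tangentPart 𝓘(ℝ, E) 𝓘(ℝ, E') φ y (V y))
      =ᶠ[𝓝 (ch (E := E) x x)] fun z ↦ (gram (E := E) x z).inverse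
        ((gram (E := E') (φ x) (rep (E := E) (E' := E') x (φ x) φ z)
          (fld (E := E) x (φ x) φ V z)) ∘L
        (fderiv ℝ (rep (E := E) (E' := E') x (φ x) φ) z)) := by
  apply eventually_ch hφ
  refine .of_forall ?_
  rintro _ ⟨y, hy, hp, rfl⟩
  beta_reduce
  rw [fld_ch _ hy, fld_ch _ hy, rep_ch hy]
  refine (isMetricOn_gram (E := E) x).eq_of_forall (ch_mem_target hy) fun c ↦ ?_
  rw [(isMetricOn_gram (E := E) x).apply_inverse (ch_mem_target hy), ← tr_trSymm hy c]
  refine (gram_tr hy _ _).trans ?_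
  rw [inner_tangentPart, ContinuousLinearMap.comp_apply, fderiv_rep hφ hy hp, gram_tr hp]

namespace SmoothAlongAt

lemma differentiableAt {V : (y : M) → TangentSpace 𝓘(ℝ, E') (φ y)}
    (hV : SmoothAlongAt (E := E) φ V x) :
    DifferentiableAt ℝ (fld (E := E) x (φ x) φ V) (ch (E := E) x x) :=
  ContDiffAt.differentiableAt hV (by simp)

lemma coordField (v : TangentSpace 𝓘(ℝ, E) x) :
    SmoothAlongAt (E := E) (id : M → M) (coordField 𝓘(ℝ, E) v) x := by
  refine (contDiffAt_const (c := tr x x v)).congr_of_eventuallyEq ?_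
  apply eventually_ch contMDiff_id
  refine .of_forall ?_
  rintro _ ⟨y, hy, -, rfl⟩
  rw [id, fld_ch _ hy, coordField_eq hy]
  exact tr_trSymm hy _

variable (hφ : ContMDiff 𝓘(ℝ, E) 𝓘(ℝ, E') ∞ φ)
include hφ

lemma mfderiv {X : (y : M) → TangentSpace 𝓘(ℝ, E) y} (hX : SmoothAlongAt (E := E) id X x) :
    SmoothAlongAt (E := E) φ (fun y ↦ mfderiv 𝓘(ℝ, E) 𝓘(ℝ, E') φ y (X y)) x :=
  (((contDiffAt_rep hφ (mem_ch_source x) (mem_ch_source (φ x))).fderiv_right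
    (by simp)).clm_apply hX).congr_of_eventuallyEq (fld_mfderiv hφ X)

lemma contDiffAt_comp_rep {F : Type*} [NormedAddCommGroup F] [NormedSpace ℝ F] {f : E' → F}
    (hf : ContDiffAt ℝ ∞ f (ch (E := E') (φ x) (φ x))) :
    ContDiffAt ℝ ∞ (fun z ↦ f (rep (E := E) (E' := E') x (φ x) φ z)) (ch (E := E) x x) := by
  refine ContDiffAt.comp _ ?_ (contDiffAt_rep hφ (mem_ch_source x) (mem_ch_source (φ x)))
  rwa [rep_ch (mem_ch_source x)]

lemma covAlong {V : (y : M) → TangentSpace 𝓘(ℝ, E') (φ y)} (hV : SmoothAlongAt (E := E) φ V x)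
    {X : (y : M) → TangentSpace 𝓘(ℝ, E) y} (hX : SmoothAlongAt (E := E) id X x) :
    SmoothAlongAt (E := E) φ (fun y ↦ covAlong 𝓘(ℝ, E) 𝓘(ℝ, E') φ V y (X y)) x := by
  refine ContDiffAt.congr_of_eventuallyEq ?_ (fld_covAlong hφ hV X)
  have h1 := ((contDiffAt_rep hφ (mem_ch_source (E := E) x)
    (mem_ch_source (E := E') (φ x))).fderiv_right (m := ∞) (by simp)).clm_apply hX
  have h2 := contDiffAt_comp_rep (x := x) hφ ((isMetricOn_gram (E := E') (φ x)).contDiffAt_chris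
    (ch_mem_target (mem_ch_source _)))
  exact ((ContDiffAt.fderiv_right hV (m := ∞) (by simp)).clm_apply hX).add
    ((h2.clm_apply h1).clm_apply hV)

lemma tangentPart {V : (y : M) → TangentSpace 𝓘(ℝ, E') (φ y)}
    (hV : SmoothAlongAt (E := E) φ V x) :
    SmoothAlongAt (E := E) id (fun y ↦ tangentPart 𝓘(ℝ, E) 𝓘(ℝ, E') φ y (V y)) x := by
  refine ContDiffAt.congr_of_eventuallyEq ?_ (fld_tangentPart hφ V)
  have h1 := ((contDiffAt_rep hφ (mem_ch_source (E := E) x)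
    (mem_ch_source (E := E') (φ x))).fderiv_right (m := ∞) (by simp))
  have h2 := contDiffAt_comp_rep (x := x) hφ ((isMetricOn_gram (E := E') (φ x)).contDiffAt
    (ch_mem_target (mem_ch_source _)))
  exact ((isMetricOn_gram (E := E) x).contDiffAt_inverse
    (ch_mem_target (mem_ch_source _))).clm_apply ((h2.clm_apply hV).clm_comp h1)

omit hφ in
lemma sub {V W : (y : M) → TangentSpace 𝓘(ℝ, E') (φ y)} (hV : SmoothAlongAt (E := E) φ V x)
    (hW : SmoothAlongAt (E := E) φ W x) : SmoothAlongAt (E := E) φ (fun y ↦ V y - W y) x := by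
  refine (ContDiffAt.sub hV hW).congr_of_eventuallyEq (.of_forall fun z ↦ ?_)
  exact map_sub _ _ _

omit hφ in
lemma neg {V : (y : M) → TangentSpace 𝓘(ℝ, E') (φ y)} (hV : SmoothAlongAt (E := E) φ V x) :
    SmoothAlongAt (E := E) φ (fun y ↦ - V y) x := by
  refine (ContDiffAt.neg hV).congr_of_eventuallyEq (.of_forall fun z ↦ ?_)
  exact map_neg _ _

omit hφ in
lemma const_smul {V : (y : M) → TangentSpace 𝓘(ℝ, E') (φ y)} (c : ℝ)
    (hV : SmoothAlongAt (E := E) φ V x) : SmoothAlongAt (E := E) φ (fun y ↦ c • V y) x := by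
  refine (ContDiffAt.const_smul c hV).congr_of_eventuallyEq (.of_forall fun z ↦ ?_)
  exact map_smul _ _ _

end SmoothAlongAt

variable (hφ : ContMDiff 𝓘(ℝ, E) 𝓘(ℝ, E') ∞ φ)
include hφ

lemma covAlong_sub {V W : (y : M) → TangentSpace 𝓘(ℝ, E') (φ y)}
    (hV : SmoothAlongAt (E := E) φ V x) (hW : SmoothAlongAt (E := E) φ W x)
    (u : TangentSpace 𝓘(ℝ, E) x) :
    covAlong 𝓘(ℝ, E) 𝓘(ℝ, E') φ (fun y ↦ V y - W y) x u =
      covAlong 𝓘(ℝ, E) 𝓘(ℝ, E') φ V x u - covAlong 𝓘(ℝ, E) 𝓘(ℝ, E') φ W x u := by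
  have hx := mem_ch_source (E := E) x
  have hp := mem_ch_source (E := E') (φ x)
  apply tr_injective hp
  have e : fld (E := E) x (φ x) φ (fun y ↦ V y - W y) =
      fld (E := E) x (φ x) φ V - fld (E := E) x (φ x) φ W := by
    ext z; exact map_sub _ _ _
  rw [map_sub, tr_covAlong hφ hx hp (hV.sub hW).differentiableAt,
    tr_covAlong hφ hx hp hV.differentiableAt, tr_covAlong hφ hx hp hW.differentiableAt, e,
    fderiv_sub hV.differentiableAt hW.differentiableAt, sub_apply, map_sub, map_sub]
  abel

lemma covAlong_const_smul {V : (y : M) → TangentSpace 𝓘(ℝ, E') (φ y)} (c : ℝ)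
    (hV : SmoothAlongAt (E := E) φ V x) (u : TangentSpace 𝓘(ℝ, E) x) :
    covAlong 𝓘(ℝ, E) 𝓘(ℝ, E') φ (fun y ↦ c • V y) x u =
      c • covAlong 𝓘(ℝ, E) 𝓘(ℝ, E') φ V x u := by
  have hx := mem_ch_source (E := E) x
  have hp := mem_ch_source (E := E') (φ x)
  apply tr_injective hp
  have e : fld (E := E) x (φ x) φ (fun y ↦ c • V y) = c • fld (E := E) x (φ x) φ V := by
    ext z; exact map_smul _ _ _
  rw [map_smul, tr_covAlong hφ hx hp (hV.const_smul c).differentiableAt,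
    tr_covAlong hφ hx hp hV.differentiableAt, e,
    fderiv_const_smul hV.differentiableAt, smul_apply, map_smul, map_smul, smul_add]

end

/-! ### The second fundamental form and smoothness of the mean curvature. -/

section

variable {E : Type*} [NormedAddCommGroup E] [NormedSpace ℝ E] [FiniteDimensional ℝ E]
  {M : Type*} [TopologicalSpace M] [ChartedSpace E M] [IsManifold 𝓘(ℝ, E) ∞ M]
  [RiemannianBundle (fun x : M ↦ TangentSpace 𝓘(ℝ, E) x)]
  [IsContMDiffRiemannianBundle 𝓘(ℝ, E) ∞ E (fun x : M ↦ TangentSpace 𝓘(ℝ, E) x)]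
  {E' : Type*} [NormedAddCommGroup E'] [NormedSpace ℝ E'] [FiniteDimensional ℝ E']
  {N : Type*} [TopologicalSpace N] [ChartedSpace E' N] [IsManifold 𝓘(ℝ, E') ∞ N]
  [RiemannianBundle (fun x : N ↦ TangentSpace 𝓘(ℝ, E') x)]
  [IsContMDiffRiemannianBundle 𝓘(ℝ, E') ∞ E' (fun x : N ↦ TangentSpace 𝓘(ℝ, E') x)]
  {φ : M → N} {x : M}

/-- The second fundamental form of a map between open subsets of Riemannian vector spaces. -/
def secondForm (G : E → E →L[ℝ] E →L[ℝ] ℝ) (G' : E' → E' →L[ℝ] E' →L[ℝ] ℝ) (Φ : E → E')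
    (z : E) : E →L[ℝ] E →L[ℝ] E' :=
  fderiv ℝ (fderiv ℝ Φ) z + (chris G' (Φ z)).bilinearComp (fderiv ℝ Φ z) (fderiv ℝ Φ z)
    - (ContinuousLinearMap.compL ℝ E E E' (fderiv ℝ Φ z)) ∘L chris G z

omit [FiniteDimensional ℝ E] [FiniteDimensional ℝ E'] in
lemma secondForm_apply (G : E → E →L[ℝ] E →L[ℝ] ℝ) (G' : E' → E' →L[ℝ] E' →L[ℝ] ℝ) (Φ : E → E')
    (z a b : E) : secondForm G G' Φ z a b =
      fderiv ℝ (fderiv ℝ Φ) z a b + chris G' (Φ z) (fderiv ℝ Φ z a) (fderiv ℝ Φ z b)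
        - fderiv ℝ Φ z (chris G z a b) := rfl

/-- The second fundamental form of `φ` in the charts at `x` and `φ x`. -/
abbrev chartForm (φ : M → N) (x : M) (z : E) : E →L[ℝ] E →L[ℝ] E' :=
  secondForm (gram (E := E) x) (gram (E := E') (φ x)) (rep (E := E) (E' := E') x (φ x) φ) z

section Tensoriality

variable (hφ : ContMDiff 𝓘(ℝ, E) 𝓘(ℝ, E') ∞ φ)
include hφ

/-- Tensoriality: the derivative of `X` occurs in both terms and cancels, so only the value of `X`
at `y` matters. -/
lemma tr_covAlong_mfderiv_sub {y : M} (hy : y ∈ (ch (E := E) x).source)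
    (hp : φ y ∈ (ch (E := E') (φ x)).source) {X : (y : M) → TangentSpace 𝓘(ℝ, E) y}
    (hX : DifferentiableAt ℝ (fld (E := E) x x id X) (ch (E := E) x y))
    (u : TangentSpace 𝓘(ℝ, E) y) :
    tr (φ x) (φ y) (covAlong 𝓘(ℝ, E) 𝓘(ℝ, E') φ
        (fun y ↦ mfderiv 𝓘(ℝ, E) 𝓘(ℝ, E') φ y (X y)) y u
      - mfderiv 𝓘(ℝ, E) 𝓘(ℝ, E') φ y (leviCivita 𝓘(ℝ, E) X y u)) =
    chartForm (E := E) (E' := E') φ x (ch (E := E) x y) (tr x y u) (tr x y (X y)) := by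
  have heq : fld (E := E) x (φ x) φ (fun y ↦ mfderiv 𝓘(ℝ, E) 𝓘(ℝ, E') φ y (X y))
      =ᶠ[𝓝 (ch (E := E) x y)]
        fun z ↦ fderiv ℝ (rep (E := E) (E' := E') x (φ x) φ) z (fld x x id X z) := by
    filter_upwards [eventually_mem_sources hφ hy hp] with z hz
    obtain ⟨y, hy, rfl⟩ : ∃ y ∈ (ch (E := E) x).source, ch (E := E) x y = z :=
      ⟨_, (ch (E := E) x).map_target hz.1, (ch (E := E) x).right_inv hz.1⟩
    have h2 := hz.2
    rw [(ch (E := E) x).left_inv hy] at h2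
    rw [fld_ch _ hy, fld_ch _ hy]
    exact (fderiv_rep hφ hy h2 _).symm
  have hr : HasFDerivAt (fderiv ℝ (rep (E := E) (E' := E') x (φ x) φ)) _ (ch (E := E) x y) :=
    (((contDiffAt_rep hφ hy hp).fderiv_right (m := 1)
      (WithTop.coe_le_coe.2 le_top)).differentiableAt (by simp)).hasFDerivAt
  have hd := (hr.clm_apply hX.hasFDerivAt).congr_of_eventuallyEq heq
  have hfx := fld_ch (E := E) (x := x) (p := x) (φ := id) X hy
  rw [map_sub, tr_covAlong hφ hy hp hd.differentiableAt, hd.fderiv, ← fderiv_rep hφ hy hp,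
    ← fderiv_rep hφ hy hp, ← fderiv_rep hφ hy hp, tr_leviCivita hy hX, secondForm_apply, rep_ch hy,
    map_add]
  simp only [add_apply, ContinuousLinearMap.comp_apply, ContinuousLinearMap.flip_apply, hfx]
  dsimp only [id]
  abel

-- A field with constant components in the chart at `w` has components `D(trans w x) b` in the chart
-- at `x`. This is needed because `coordField` at a nearby point `y` refers to the chart at `y`.
omit hφ in
lemma differentiableAt_fld_trSymm {x w y : M} (hx : y ∈ (ch (E := E) x).source)
    (hw : y ∈ (ch (E := E) w).source) (b : E) :
    DifferentiableAt ℝ (fld (E := E) x x id (fun q : M ↦ trSymm w q b)) (ch (E := E) x y) := by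
  have h1 : DifferentiableAt ℝ (fun z ↦ fderiv ℝ (trans (E := E) w x)
      (trans (E := E) x w z) b) (ch (E := E) x y) := by
    have h2 := (contDiffAt_trans hx hw).differentiableAt (by simp)
    have h3 : DifferentiableAt ℝ (fderiv ℝ (trans (E := E) w x))
        (trans (E := E) x w (ch (E := E) x y)) := by
      rw [trans_apply hx hw]
      exact ((contDiffAt_trans hw hx).fderiv_right (m := 1)
        (WithTop.coe_le_coe.2 le_top)).differentiableAt (by simp)
    exact (h3.comp _ h2).clm_apply (differentiableAt_const _)
  refine h1.congr_of_eventuallyEq ?_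
  filter_upwards [eventually_mem_sources (φ := (id : M → M)) contMDiff_id hx hw] with z hz
  obtain ⟨q, hq, rfl⟩ : ∃ y ∈ (ch (E := E) x).source, ch (E := E) x y = z :=
    ⟨_, (ch (E := E) x).map_target hz.1, (ch (E := E) x).right_inv hz.1⟩
  have h2 := hz.2
  rw [(ch (E := E) x).left_inv hq] at h2
  dsimp only [id] at h2
  rw [fld_ch _ hq, trans_apply hq h2]
  have := fderiv_trans h2 hq (trSymm w q b)
  rw [tr_trSymm h2] at this
  exact this.symm

omit hφ in
lemma differentiableAt_fld_coordField {y : M} (hy : y ∈ (ch (E := E) x).source)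
    (v : TangentSpace 𝓘(ℝ, E) y) :
    DifferentiableAt ℝ (fld (E := E) x x id (coordField 𝓘(ℝ, E) v)) (ch (E := E) x y) := by
  have hyy := mem_ch_source (E := E) y
  refine (differentiableAt_fld_trSymm hy hyy (tr y y v)).congr_of_eventuallyEq ?_
  filter_upwards [eventually_mem_sources (φ := (id : M → M)) contMDiff_id hy hyy] with z hz
  exact congrArg (tr x ((ch (E := E) x).symm z)) (coordField_eq hz.2 v)

lemma tr_secondFundForm {y : M} (hy : y ∈ (ch (E := E) x).source)
    (hp : φ y ∈ (ch (E := E') (φ x)).source) (u v : TangentSpace 𝓘(ℝ, E) y) :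
    tr (φ x) (φ y) (secondFundForm 𝓘(ℝ, E) 𝓘(ℝ, E') φ y u v) =
      chartForm (E := E) (E' := E') φ x (ch (E := E) x y) (tr x y u) (tr x y v) := by
  rw [secondFundForm, tr_covAlong_mfderiv_sub hφ hy hp (differentiableAt_fld_coordField hy v),
    coordField_self]

lemma covAlong_mfderiv {X : (y : M) → TangentSpace 𝓘(ℝ, E) y}
    (hX : SmoothAlongAt (E := E) id X x) (u : TangentSpace 𝓘(ℝ, E) x) :
    covAlong 𝓘(ℝ, E) 𝓘(ℝ, E') φ (fun y ↦ mfderiv 𝓘(ℝ, E) 𝓘(ℝ, E') φ y (X y)) x u =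
      mfderiv 𝓘(ℝ, E) 𝓘(ℝ, E') φ x (leviCivita 𝓘(ℝ, E) X x u)
        + secondFundForm 𝓘(ℝ, E) 𝓘(ℝ, E') φ x u (X x) := by
  have hx := mem_ch_source (E := E) x
  have hp := mem_ch_source (E := E') (φ x)
  rw [← sub_eq_iff_eq_add']
  apply tr_injective hp
  rw [tr_covAlong_mfderiv_sub hφ hx hp hX.differentiableAt, tr_secondFundForm hφ hx hp]

lemma secondFundForm_symm (u v : TangentSpace 𝓘(ℝ, E) x) :
    secondFundForm 𝓘(ℝ, E) 𝓘(ℝ, E') φ x u v = secondFundForm 𝓘(ℝ, E) 𝓘(ℝ, E') φ x v u := by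
  have hx := mem_ch_source (E := E) x
  have hp := mem_ch_source (E := E') (φ x)
  apply tr_injective hp
  rw [tr_secondFundForm hφ hx hp, tr_secondFundForm hφ hx hp, secondForm_apply, secondForm_apply]
  rw [(isMetricOn_gram (E := E) x).chris_symm (ch_mem_target hx) _ (tr x x u),
    (isMetricOn_gram (E := E') (φ x)).chris_symm (by rw [rep_ch hx]; exact ch_mem_target hp),
    ((contDiffAt_rep hφ hx hp).of_le (m := 2) (WithTop.coe_le_coe.2 le_top)).isSymmSndFDerivAt
      (by simp) (tr x x u) (tr x x v)]

/-- The differentiated isometry condition, `isometric_secondForm_orthogonal`, read in charts. -/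
lemma inner_secondFundForm
    (hiso : ∀ (x : M) (u v : TangentSpace 𝓘(ℝ, E) x),
      inner ℝ (mfderiv 𝓘(ℝ, E) 𝓘(ℝ, E') φ x u) (mfderiv 𝓘(ℝ, E) 𝓘(ℝ, E') φ x v) = inner ℝ u v)
    (u v w : TangentSpace 𝓘(ℝ, E) x) :
    inner ℝ (secondFundForm 𝓘(ℝ, E) 𝓘(ℝ, E') φ x u v) (mfderiv 𝓘(ℝ, E) 𝓘(ℝ, E') φ x w) = 0 := by
  have hx := mem_ch_source (E := E) x
  have hp := mem_ch_source (E := E') (φ x)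
  have key := isometric_secondForm_orthogonal (isMetricOn_gram (E := E) x)
    (isMetricOn_gram (E := E') (φ x)) (Φ := rep (E := E) (E' := E') x (φ x) φ) (ch_mem_target hx)
    (by rw [rep_ch hx]; exact ch_mem_target hp)
    ((contDiffAt_rep hφ hx hp).of_le (WithTop.coe_le_coe.2 le_top))
    (by
      filter_upwards [eventually_mem_sources hφ hx hp] with z hz a b
      exact gram_rep hφ hiso hz.1 hz.2 a b) (tr x x u) (tr x x v) (tr x x w)
  rw [← gram_tr hp, tr_secondFundForm hφ hx hp, ← fderiv_rep hφ hx hp, secondForm_apply,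
    ← rep_ch hx]
  exact key

end Tensoriality

section MeanCurvature

/-- Replaces the orthonormal basis chosen at each `y` by a fixed basis of `E` contracted with the
inverse metric, a form of the trace that is smooth in `y`. -/
lemma sum_tr_eq {F : Type*} [NormedAddCommGroup F] [NormedSpace ℝ F] {y : M}
    (hy : y ∈ (ch (E := E) x).source) (T : E →L[ℝ] E →L[ℝ] F) :
    ∑ i, T (tr x y (stdOrthonormalBasis ℝ (TangentSpace 𝓘(ℝ, E) y) i))
        (tr x y (stdOrthonormalBasis ℝ (TangentSpace 𝓘(ℝ, E) y) i)) =
      ∑ j, T ((gram (E := E) x (ch (E := E) x y)).inverse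
        (LinearMap.toContinuousLinearMap ((Module.finBasis ℝ E).coord j)))
        (Module.finBasis ℝ E j) := by
  set e := stdOrthonormalBasis ℝ (TangentSpace 𝓘(ℝ, E) y)
  set b := Module.finBasis ℝ E
  -- The inverse metric is `∑ e_i ⊗ e_i` for every orthonormal basis.
  have h1 (j) : (gram (E := E) x (ch (E := E) x y)).inverse
      (LinearMap.toContinuousLinearMap (b.coord j)) =
      ∑ i, b.coord j (tr x y (e i)) • tr x y (e i) := by
    refine (isMetricOn_gram (E := E) x).eq_of_forall (ch_mem_target hy) fun c ↦ ?_
    rw [(isMetricOn_gram (E := E) x).apply_inverse (ch_mem_target hy), ← tr_trSymm hy c]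
    set w := trSymm x y c
    have h2 : ∑ i, b.coord j (tr x y (e i)) • tr x y (e i) =
      tr x y (∑ i, b.coord j (tr x y (e i)) • e i) := by simp only [map_sum, map_smul]
    rw [h2, gram_tr hy, sum_inner]
    have h3 : w = ∑ i, inner ℝ (e i) w • e i := (OrthonormalBasis.sum_repr' e w).symm
    conv_lhs => rw [h3]
    simp only [map_sum, map_smul, LinearMap.coe_toContinuousLinearMap', inner_smul_left, smul_eq_mul]
    refine Finset.sum_congr rfl fun i _ ↦ ?_
    simp [mul_comm]
  simp only [h1, map_sum, map_smul, sum_apply, smul_apply]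
  rw [Finset.sum_comm]
  refine Finset.sum_congr rfl fun i _ ↦ ?_
  refine (congrArg (T (tr x y (e i))) (b.sum_repr (tr x y (e i))).symm).trans ?_
  simp only [map_sum, map_smul, Module.Basis.coord_apply]

lemma smoothAlongAt_meanCurvature (hφ : ContMDiff 𝓘(ℝ, E) 𝓘(ℝ, E') ∞ φ) (x : M) :
    SmoothAlongAt (E := E) φ (meanCurvature 𝓘(ℝ, E) 𝓘(ℝ, E') φ) x := by
  have hx := mem_ch_source (E := E) x
  have hp := mem_ch_source (E := E') (φ x)
  have heq : fld (E := E) x (φ x) φ (meanCurvature 𝓘(ℝ, E) 𝓘(ℝ, E') φ)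
      =ᶠ[𝓝 (ch (E := E) x x)] fun z ↦ (Module.finrank ℝ E : ℝ)⁻¹ •
        ∑ j, chartForm (E := E) (E' := E') φ x z ((gram (E := E) x z).inverse
        (LinearMap.toContinuousLinearMap ((Module.finBasis ℝ E).coord j)))
        (Module.finBasis ℝ E j) := by
    apply eventually_ch hφ
    refine .of_forall ?_
    rintro _ ⟨y, hy, hp, rfl⟩
    beta_reduce
    rw [fld_ch _ hy, meanCurvature, map_smul, metricTrace, map_sum]
    simp only [tr_secondFundForm hφ hy hp]
    rw [sum_tr_eq hy]
  refine ContDiffAt.congr_of_eventuallyEq ?_ heq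
  refine ContDiffAt.const_smul _ (ContDiffAt.sum fun j _ ↦ ?_)
  simp only [secondForm_apply]
  have hi := ((isMetricOn_gram (E := E) x).contDiffAt_inverse (ch_mem_target hx)).clm_apply
    (contDiffAt_const (c := LinearMap.toContinuousLinearMap ((Module.finBasis ℝ E).coord j)))
  have hb := contDiffAt_const (𝕜 := ℝ) (n := ∞) (x := ch (E := E) x x)
    (c := Module.finBasis ℝ E j)
  have h1 := (contDiffAt_rep hφ hx hp).fderiv_right (m := ∞) (by simp)
  have h2 := h1.fderiv_right (m := ∞) (by simp)
  have h3 := SmoothAlongAt.contDiffAt_comp_rep (x := x) hφ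
    ((isMetricOn_gram (E := E') (φ x)).contDiffAt_chris (ch_mem_target hp))
  have h4 := (isMetricOn_gram (E := E) x).contDiffAt_chris (ch_mem_target hx)
  exact (((h2.clm_apply hi).clm_apply hb).add
    ((h3.clm_apply (h1.clm_apply hi)).clm_apply (h1.clm_apply hb))).sub
    (h1.clm_apply ((h4.clm_apply hi).clm_apply hb))

end MeanCurvature

end

/-! ### Gauss and Weingarten formulas; splitting of the rough Laplacian. -/

section

variable {E : Type*} [NormedAddCommGroup E] [NormedSpace ℝ E] [FiniteDimensional ℝ E]
  {M : Type*} [TopologicalSpace M] [ChartedSpace E M] [IsManifold 𝓘(ℝ, E) ∞ M]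
  [RiemannianBundle (fun x : M ↦ TangentSpace 𝓘(ℝ, E) x)]
  [IsContMDiffRiemannianBundle 𝓘(ℝ, E) ∞ E (fun x : M ↦ TangentSpace 𝓘(ℝ, E) x)]
  {E' : Type*} [NormedAddCommGroup E'] [NormedSpace ℝ E'] [FiniteDimensional ℝ E']
  {N : Type*} [TopologicalSpace N] [ChartedSpace E' N] [IsManifold 𝓘(ℝ, E') ∞ N]
  [RiemannianBundle (fun x : N ↦ TangentSpace 𝓘(ℝ, E') x)]
  [IsContMDiffRiemannianBundle 𝓘(ℝ, E') ∞ E' (fun x : N ↦ TangentSpace 𝓘(ℝ, E') x)]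
  {φ : M → N} {x : M}

lemma covAlong_eq_weingarten (ξ : (y : M) → TangentSpace 𝓘(ℝ, E') (φ y)) (y : M)
    (v : TangentSpace 𝓘(ℝ, E) y) :
    covAlong 𝓘(ℝ, E) 𝓘(ℝ, E') φ ξ y v = normalConnection 𝓘(ℝ, E) 𝓘(ℝ, E') φ ξ y v
      - mfderiv 𝓘(ℝ, E) 𝓘(ℝ, E') φ y (shapeOperator 𝓘(ℝ, E) 𝓘(ℝ, E') φ ξ y v) := by
  simp [normalConnection, shapeOperator, normalPart]

lemma smoothAlongAt_shapeOperator (hφ : ContMDiff 𝓘(ℝ, E) 𝓘(ℝ, E') ∞ φ)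
    {ξ : (y : M) → TangentSpace 𝓘(ℝ, E') (φ y)} (hξ : SmoothAlongAt (E := E) φ ξ x)
    {X : (y : M) → TangentSpace 𝓘(ℝ, E) y} (hX : SmoothAlongAt (E := E) id X x) :
    SmoothAlongAt (E := E) (id : M → M)
      (fun y ↦ shapeOperator 𝓘(ℝ, E) 𝓘(ℝ, E') φ ξ y (X y)) x :=
  ((hξ.covAlong hφ hX).tangentPart hφ).neg

lemma smoothAlongAt_normalConnection (hφ : ContMDiff 𝓘(ℝ, E) 𝓘(ℝ, E') ∞ φ)
    {ξ : (y : M) → TangentSpace 𝓘(ℝ, E') (φ y)} (hξ : SmoothAlongAt (E := E) φ ξ x)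
    {X : (y : M) → TangentSpace 𝓘(ℝ, E) y} (hX : SmoothAlongAt (E := E) id X x) :
    SmoothAlongAt (E := E) φ (fun y ↦ normalConnection 𝓘(ℝ, E) 𝓘(ℝ, E') φ ξ y (X y)) x :=
  (hξ.covAlong hφ hX).sub (((hξ.covAlong hφ hX).tangentPart hφ).mfderiv hφ)

/-- The Gauss and Weingarten formulas for the second covariant derivative of a field along `φ`. -/
lemma covAlong_covAlong (hφ : ContMDiff 𝓘(ℝ, E) 𝓘(ℝ, E') ∞ φ)
    {ξ : (y : M) → TangentSpace 𝓘(ℝ, E') (φ y)} (hξ : SmoothAlongAt (E := E) φ ξ x)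
    (u v : TangentSpace 𝓘(ℝ, E) x) :
    covAlong 𝓘(ℝ, E) 𝓘(ℝ, E') φ
        (fun y ↦ covAlong 𝓘(ℝ, E) 𝓘(ℝ, E') φ ξ y (coordField 𝓘(ℝ, E) v y)) x u
      - covAlong 𝓘(ℝ, E) 𝓘(ℝ, E') φ ξ x (leviCivita 𝓘(ℝ, E) (coordField 𝓘(ℝ, E) v) x u) =
    (normalConnection 𝓘(ℝ, E) 𝓘(ℝ, E') φ
        (fun y ↦ normalConnection 𝓘(ℝ, E) 𝓘(ℝ, E') φ ξ y (coordField 𝓘(ℝ, E) v y)) x u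
      - normalConnection 𝓘(ℝ, E) 𝓘(ℝ, E') φ ξ x
        (leviCivita 𝓘(ℝ, E) (coordField 𝓘(ℝ, E) v) x u))
      - secondFundForm 𝓘(ℝ, E) 𝓘(ℝ, E') φ x (shapeOperator 𝓘(ℝ, E) 𝓘(ℝ, E') φ ξ x v) u
      - mfderiv 𝓘(ℝ, E) 𝓘(ℝ, E') φ x (covShapeOperator 𝓘(ℝ, E) 𝓘(ℝ, E') φ ξ x u v
        + shapeNormalDeriv 𝓘(ℝ, E) 𝓘(ℝ, E') φ ξ x v u) := by
  have hv := SmoothAlongAt.coordField (E := E) v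
  have hA := smoothAlongAt_shapeOperator hφ hξ hv
  have hN := smoothAlongAt_normalConnection hφ hξ hv
  have e : (fun y ↦ covAlong 𝓘(ℝ, E) 𝓘(ℝ, E') φ ξ y (coordField 𝓘(ℝ, E) v y)) = fun y ↦
      normalConnection 𝓘(ℝ, E) 𝓘(ℝ, E') φ ξ y (coordField 𝓘(ℝ, E) v y)
      - mfderiv 𝓘(ℝ, E) 𝓘(ℝ, E') φ y
        (shapeOperator 𝓘(ℝ, E) 𝓘(ℝ, E') φ ξ y (coordField 𝓘(ℝ, E) v y)) :=
    funext fun y ↦ covAlong_eq_weingarten ξ y _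
  -- The Gauss formula applies to the tangential field `dφ(A_ξ V)`, and the Weingarten splitting
  -- both to `ξ` and to the field `∇^⊥_V ξ`.
  rw [e, covAlong_sub hφ hN (hA.mfderiv hφ), covAlong_mfderiv hφ hA, covAlong_eq_weingarten ξ,
    covAlong_eq_weingarten (fun y ↦ normalConnection 𝓘(ℝ, E) 𝓘(ℝ, E') φ ξ y
      (coordField 𝓘(ℝ, E) v y)), secondFundForm_symm hφ _ u, coordField_self, covShapeOperator,
    shapeNormalDeriv, map_add, map_sub]
  abel

/-- The decomposition of the rough Laplacian into normal and tangential parts. -/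
theorem roughLaplacian_eq (hφ : ContMDiff 𝓘(ℝ, E) 𝓘(ℝ, E') ∞ φ)
    {ξ : (y : M) → TangentSpace 𝓘(ℝ, E') (φ y)} (hξ : SmoothAlongAt (E := E) φ ξ x) :
    roughLaplacian 𝓘(ℝ, E) 𝓘(ℝ, E') φ ξ x =
      mfderiv 𝓘(ℝ, E) 𝓘(ℝ, E') φ x
        (metricTrace 𝓘(ℝ, E) x (covShapeOperator 𝓘(ℝ, E) 𝓘(ℝ, E') φ ξ x)
        + metricTrace 𝓘(ℝ, E) x (shapeNormalDeriv 𝓘(ℝ, E) 𝓘(ℝ, E') φ ξ x))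
      + (normalLaplacian 𝓘(ℝ, E) 𝓘(ℝ, E') φ ξ x
        + metricTrace 𝓘(ℝ, E) x fun u v ↦ secondFundForm 𝓘(ℝ, E) 𝓘(ℝ, E') φ x
          (shapeOperator 𝓘(ℝ, E) 𝓘(ℝ, E') φ ξ x u) v) := by
  simp only [roughLaplacian, normalLaplacian, metricTrace, covAlong_covAlong hφ hξ,
    Finset.sum_sub_distrib, map_add, map_sum, Finset.sum_add_distrib]
  abel

section Isometric

variable (hiso : ∀ (x : M) (u v : TangentSpace 𝓘(ℝ, E) x),
  inner ℝ (mfderiv 𝓘(ℝ, E) 𝓘(ℝ, E') φ x u) (mfderiv 𝓘(ℝ, E) 𝓘(ℝ, E') φ x v) = inner ℝ u v)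
include hiso

lemma inner_normalPart (w : TangentSpace 𝓘(ℝ, E') (φ x)) (c : TangentSpace 𝓘(ℝ, E) x) :
    inner ℝ (normalPart 𝓘(ℝ, E) 𝓘(ℝ, E') φ x w) (mfderiv 𝓘(ℝ, E) 𝓘(ℝ, E') φ x c) = 0 := by
  rw [normalPart, inner_sub_left, hiso, inner_tangentPart, sub_self]

lemma inner_normalLaplacian (ξ : (y : M) → TangentSpace 𝓘(ℝ, E') (φ y))
    (c : TangentSpace 𝓘(ℝ, E) x) :
    inner ℝ (normalLaplacian 𝓘(ℝ, E) 𝓘(ℝ, E') φ ξ x) (mfderiv 𝓘(ℝ, E) 𝓘(ℝ, E') φ x c) = 0 := by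
  rw [normalLaplacian, inner_neg_left, metricTrace, sum_inner, neg_eq_zero]
  refine Finset.sum_eq_zero fun i _ ↦ ?_
  rw [inner_sub_left, normalConnection, inner_normalPart hiso, normalConnection,
    inner_normalPart hiso, sub_zero]

lemma inner_meanCurvature (hφ : ContMDiff 𝓘(ℝ, E) 𝓘(ℝ, E') ∞ φ) (c : TangentSpace 𝓘(ℝ, E) x) :
    inner ℝ (meanCurvature 𝓘(ℝ, E) 𝓘(ℝ, E') φ x) (mfderiv 𝓘(ℝ, E) 𝓘(ℝ, E') φ x c) = 0 := by
  rw [meanCurvature, inner_smul_left, metricTrace, sum_inner]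
  simp [inner_secondFundForm hφ hiso]

/-- Pairing the sum with `dφ(t)` removes `w` and leaves `|t|² = 0`. -/
lemma mfderiv_add_eq_zero_iff (t : TangentSpace 𝓘(ℝ, E) x) {w : TangentSpace 𝓘(ℝ, E') (φ x)}
    (hw : ∀ c, inner ℝ w (mfderiv 𝓘(ℝ, E) 𝓘(ℝ, E') φ x c) = 0) :
    mfderiv 𝓘(ℝ, E) 𝓘(ℝ, E') φ x t + w = 0 ↔ t = 0 ∧ w = 0 := by
  refine ⟨fun h ↦ ?_, fun ⟨h1, h2⟩ ↦ by rw [h1, h2, map_zero, add_zero]⟩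
  have h1 : inner ℝ t t = 0 := by
    have h0 := congrArg (fun a ↦ inner ℝ a (mfderiv 𝓘(ℝ, E) 𝓘(ℝ, E') φ x t)) h
    simpa only [inner_add_left, hw, hiso, add_zero, inner_zero_left] using h0
  have h2 := inner_self_eq_zero.1 h1
  rw [h2, map_zero, zero_add] at h
  exact ⟨h2, h⟩

end Isometric

/-- In dimension zero the factor `m⁻¹` takes the value 0 and cannot be cancelled; there the identity
is taken from triviality of the target. -/
lemma tensionField_eq_smul (hE : Module.finrank ℝ E = 0 → Subsingleton E') :
    tensionField 𝓘(ℝ, E) 𝓘(ℝ, E') φ = fun x ↦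
      (Module.finrank ℝ E : ℝ) • meanCurvature 𝓘(ℝ, E) 𝓘(ℝ, E') φ x := by
  funext x
  rcases eq_or_ne (Module.finrank ℝ E) 0 with h | h
  · exact @Subsingleton.elim E' (hE h) _ _
  · rw [meanCurvature, smul_inv_smul₀ (by exact_mod_cast h), tensionField]

lemma roughLaplacian_const_smul (hφ : ContMDiff 𝓘(ℝ, E) 𝓘(ℝ, E') ∞ φ) (c : ℝ)
    {ξ : (y : M) → TangentSpace 𝓘(ℝ, E') (φ y)} (hξ : ∀ x, SmoothAlongAt (E := E) φ ξ x) (x : M) :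
    roughLaplacian 𝓘(ℝ, E) 𝓘(ℝ, E') φ (fun y ↦ c • ξ y) x =
      c • roughLaplacian 𝓘(ℝ, E) 𝓘(ℝ, E') φ ξ x := by
  simp only [roughLaplacian, metricTrace, smul_neg, Finset.smul_sum, smul_sub]
  refine congrArg Neg.neg (Finset.sum_congr rfl fun i _ ↦ ?_)
  have e (v : TangentSpace 𝓘(ℝ, E) x) : (fun y ↦ covAlong 𝓘(ℝ, E) 𝓘(ℝ, E') φ (fun y ↦ c • ξ y) y
      (coordField 𝓘(ℝ, E) v y)) =
      fun y ↦ c • covAlong 𝓘(ℝ, E) 𝓘(ℝ, E') φ ξ y (coordField 𝓘(ℝ, E) v y) :=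
    funext fun y ↦ covAlong_const_smul hφ c (hξ y) _
  rw [e, covAlong_const_smul hφ c (hξ x),
    covAlong_const_smul hφ c ((hξ x).covAlong hφ (SmoothAlongAt.coordField _))]

end

/-! ### Lie bracket and curvature in a chart. -/

section

variable {E : Type*} [NormedAddCommGroup E] [NormedSpace ℝ E] [FiniteDimensional ℝ E]
  {M : Type*} [TopologicalSpace M] [ChartedSpace E M] [IsManifold 𝓘(ℝ, E) ∞ M]
  [RiemannianBundle (fun x : M ↦ TangentSpace 𝓘(ℝ, E) x)]
  [IsContMDiffRiemannianBundle 𝓘(ℝ, E) ∞ E (fun x : M ↦ TangentSpace 𝓘(ℝ, E) x)]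
  {p : M}

lemma eventually_ch_self {P : E → Prop}
    (h : ∀ᶠ z in 𝓝 (ch (E := E) p p), (∃ y ∈ (ch (E := E) p).source, z = ch (E := E) p y) → P z) :
    ∀ᶠ z in 𝓝 (ch (E := E) p p), P z := by
  filter_upwards [h, (ch_target_open (E := E) p).mem_nhds (ch_mem_target (mem_ch_source p))]
    with z h1 h2
  exact h1 ⟨_, (ch (E := E) p).map_target h2, ((ch (E := E) p).right_inv h2).symm⟩

lemma fld_coordField (v : TangentSpace 𝓘(ℝ, E) p) :
    fld (E := E) p p id (coordField 𝓘(ℝ, E) v) =ᶠ[𝓝 (ch (E := E) p p)] fun _ ↦ tr p p v := by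
  apply eventually_ch_self
  refine .of_forall ?_
  rintro _ ⟨y, hy, rfl⟩
  rw [fld_ch _ hy, coordField_eq hy]
  exact tr_trSymm hy _

lemma inverse_trSymm {q : M} (hq : q ∈ (ch (E := E) p).source) :
    (trSymm (E := E) p q).inverse = tr p q :=
  ContinuousLinearMap.inverse_eq (by ext a; exact trSymm_tr hq a) (by ext a; exact tr_trSymm hq a)

lemma inverse_tr {q : M} (hq : q ∈ (ch (E := E) p).source) :
    (tr (E := E) p q).inverse = trSymm p q :=
  ContinuousLinearMap.inverse_eq (by ext a; exact tr_trSymm hq a) (by ext a; exact trSymm_tr hq a)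

lemma mpullbackWithin_ch_symm (V : (y : M) → TangentSpace 𝓘(ℝ, E) y) {z : E}
    (hz : z ∈ (ch (E := E) p).target) :
    VectorField.mpullbackWithin 𝓘(ℝ, E) 𝓘(ℝ, E) (extChartAt 𝓘(ℝ, E) p).symm V
      (Set.range 𝓘(ℝ, E)) z = fld (E := E) p p id V z := by
  have hy := (ch (E := E) p).map_target hz
  have h := TangentBundle.symmL_trivializationAt (I := 𝓘(ℝ, E)) (x₀ := p)
    (x := (ch (E := E) p).symm z) (by simpa using hy)
  rw [(ch (E := E) p).right_inv hz] at h
  rw [VectorField.mpullbackWithin_apply, ← h]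
  exact DFunLike.congr_fun (inverse_trSymm hy) _

/-- The Lie bracket in the preferred chart. -/
lemma tr_mlieBracket (V W : (y : M) → TangentSpace 𝓘(ℝ, E) y) :
    tr p p (VectorField.mlieBracket 𝓘(ℝ, E) V W p) =
      fderiv ℝ (fld (E := E) p p id W) (ch (E := E) p p) (tr p p (V p))
      - fderiv ℝ (fld (E := E) p p id V) (ch (E := E) p p) (tr p p (W p)) := by
  have hp := mem_ch_source (E := E) p
  have e (V : (y : M) → TangentSpace 𝓘(ℝ, E) y) :
      VectorField.mpullbackWithin 𝓘(ℝ, E) 𝓘(ℝ, E) (extChartAt 𝓘(ℝ, E) p).symm V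
      (Set.range 𝓘(ℝ, E)) =ᶠ[𝓝 (ch (E := E) p p)] fld (E := E) p p id V := by
    filter_upwards [(ch_target_open (E := E) p).mem_nhds (ch_mem_target hp)] with z hz
    exact mpullbackWithin_ch_symm V hz
  have h1 : VectorField.mlieBracket 𝓘(ℝ, E) V W p = trSymm p p
      (VectorField.lieBracket ℝ (fld (E := E) p p id V) (fld (E := E) p p id W)
        (ch (E := E) p p)) := by
    rw [← VectorField.mlieBracketWithin_univ, VectorField.mlieBracketWithin_apply,
      ← inverse_tr hp, tr_eq_mvfderiv hp]
    have h2 : (extChartAt 𝓘(ℝ, E) p).symm ⁻¹' Set.univ ∩ Set.range 𝓘(ℝ, E) = Set.univ := by simp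
    have h3 (A B A' B' : E → E) (hA : A =ᶠ[𝓝 (ch (E := E) p p)] A')
        (hB : B =ᶠ[𝓝 (ch (E := E) p p)] B') :
        VectorField.lieBracketWithin ℝ A B ((extChartAt 𝓘(ℝ, E) p).symm ⁻¹' Set.univ ∩
          Set.range 𝓘(ℝ, E)) (ch (E := E) p p) =
        VectorField.lieBracket ℝ A' B' (ch (E := E) p p) := by
      rw [h2, VectorField.lieBracketWithin_univ]
      exact hA.lieBracket_vectorField_eq hB
    exact congrArg _ (h3 _ _ _ _ (e V) (e W))
  rw [h1, tr_trSymm hp, VectorField.lieBracket]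
  have f1 := fld_ch (E := E) (x := p) (p := p) (φ := id) V hp
  have f2 := fld_ch (E := E) (x := p) (p := p) (φ := id) W hp
  rw [f1, f2]
  rfl

lemma fld_leviCivita_coordField (v w : TangentSpace 𝓘(ℝ, E) p) :
    fld (E := E) p p id (fun q ↦ leviCivita 𝓘(ℝ, E) (coordField 𝓘(ℝ, E) w) q
      (coordField 𝓘(ℝ, E) v q)) =ᶠ[𝓝 (ch (E := E) p p)]
      fun z ↦ chris (gram (E := E) p) z (tr p p v) (tr p p w) := by
  apply eventually_ch_self
  filter_upwards [(fld_coordField w).eventuallyEq_nhds]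
  rintro _ h ⟨y, hy, rfl⟩
  rw [fld_ch _ hy]
  have hd : DifferentiableAt ℝ (fld (E := E) p p id (coordField 𝓘(ℝ, E) w)) (ch (E := E) p y) :=
    (differentiableAt_const _).congr_of_eventuallyEq h
  refine (tr_leviCivita hy hd _).trans ?_
  rw [h.fderiv_eq, coordField_eq hy, coordField_eq hy, tr_trSymm hy, tr_trSymm hy]
  simp

/-- Coordinate fields have constant components near `p`. Hence `∇_V W` is `Γ(v, w)` on a whole
neighbourhood, one further derivative gives `DΓ + ΓΓ`, and the bracket term vanishes. -/
lemma tr_curvature (u v w : TangentSpace 𝓘(ℝ, E) p) :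
    tr p p (curvature 𝓘(ℝ, E) p u v w) =
      curv (chris (gram (E := E) p)) (ch (E := E) p p) (tr p p u) (tr p p v) (tr p p w) := by
  have hp := mem_ch_source (E := E) p
  have hc := ((isMetricOn_gram (E := E) p).hasFDerivAt_chris (ch_mem_target hp))
  have key (u v w : TangentSpace 𝓘(ℝ, E) p) : tr p p (leviCivita 𝓘(ℝ, E)
      (fun q ↦ leviCivita 𝓘(ℝ, E) (coordField 𝓘(ℝ, E) w) q (coordField 𝓘(ℝ, E) v q)) p u) =
      fderiv ℝ (chris (gram (E := E) p)) (ch (E := E) p p) (tr p p u) (tr p p v) (tr p p w)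
      + chris (gram (E := E) p) (ch (E := E) p p) (tr p p u)
        (chris (gram (E := E) p) (ch (E := E) p p) (tr p p v) (tr p p w)) := by
    have hd := ((hc.clm_apply (hasFDerivAt_const (tr p p v) _)).clm_apply
      (hasFDerivAt_const (tr p p w) _)).congr_of_eventuallyEq (fld_leviCivita_coordField v w)
    have h0 := (fld_leviCivita_coordField v w).self_of_nhds
    have f1 := fld_ch (E := E) (x := p) (p := p) (φ := id) (fun q ↦ leviCivita 𝓘(ℝ, E)
      (coordField 𝓘(ℝ, E) w) q (coordField 𝓘(ℝ, E) v q)) hp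
    rw [tr_leviCivita hp hd.differentiableAt, hd.fderiv,
      show tr p p (leviCivita 𝓘(ℝ, E) (coordField 𝓘(ℝ, E) w) p (coordField 𝓘(ℝ, E) v p)) = _ from
        f1.symm.trans h0]
    simp
  have hb : VectorField.mlieBracket 𝓘(ℝ, E) (coordField 𝓘(ℝ, E) u) (coordField 𝓘(ℝ, E) v) p
      = 0 := by
    apply tr_injective hp
    rw [tr_mlieBracket, (fld_coordField u).fderiv_eq, (fld_coordField v).fderiv_eq]
    simp
  have h0 : tr p p (leviCivita 𝓘(ℝ, E) (coordField 𝓘(ℝ, E) w) p 0) = 0 := by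
    rw [tr_leviCivita hp ((differentiableAt_const _).congr_of_eventuallyEq (fld_coordField w))]
    simp
  rw [curvature, hb, map_sub, map_sub, key, key, h0, curv]
  abel

end

/-! ### Kähler structures and space forms in charts. -/

section

variable {E : Type*} [NormedAddCommGroup E] [NormedSpace ℝ E] [FiniteDimensional ℝ E]
  {M : Type*} [TopologicalSpace M] [ChartedSpace E M] [IsManifold 𝓘(ℝ, E) ∞ M]
  [RiemannianBundle (fun x : M ↦ TangentSpace 𝓘(ℝ, E) x)]
  [IsContMDiffRiemannianBundle 𝓘(ℝ, E) ∞ E (fun x : M ↦ TangentSpace 𝓘(ℝ, E) x)]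
  {p : M} {J : (p : M) → TangentSpace 𝓘(ℝ, E) p →L[ℝ] TangentSpace 𝓘(ℝ, E) p}

/-- An endomorphism field in the chart at `p`. -/
def endo (J : (p : M) → TangentSpace 𝓘(ℝ, E) p →L[ℝ] TangentSpace 𝓘(ℝ, E) p) (p : M) (z : E) :
    E →L[ℝ] E :=
  tr p ((ch (E := E) p).symm z) ∘L J ((ch (E := E) p).symm z) ∘L trSymm p ((ch (E := E) p).symm z)

lemma endo_tr {y : M} (hy : y ∈ (ch (E := E) p).source) (v : TangentSpace 𝓘(ℝ, E) y) :
    endo J p (ch (E := E) p y) (tr p y v) = tr p y (J y v) := by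
  simp only [endo, ContinuousLinearMap.comp_apply]
  rw [(ch (E := E) p).left_inv hy, trSymm_tr hy]

lemma fld_endo (W : (y : M) → TangentSpace 𝓘(ℝ, E) y) {z : E}
    (hz : z ∈ (ch (E := E) p).target) :
    fld (E := E) p p id (fun y ↦ J y (W y)) z = endo J p z (fld (E := E) p p id W z) := by
  obtain ⟨y, hy, rfl⟩ : ∃ y ∈ (ch (E := E) p).source, ch (E := E) p y = z :=
    ⟨_, (ch (E := E) p).map_target hz, (ch (E := E) p).right_inv hz⟩
  rw [fld_ch _ hy, fld_ch _ hy]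
  exact (endo_tr hy _).symm

section Kaehler

variable (hJ : IsKaehler 𝓘(ℝ, E) J)
include hJ

lemma contDiffOn_endo : ContDiffOn ℝ ∞ (endo J p) (ch (E := E) p).target := by
  rw [contDiffOn_clm_apply]
  intro a z hz
  have hs := (ch (E := E) p).map_target hz
  have h1 : ContMDiffAt 𝓘(ℝ, E) 𝓘(ℝ, E) ∞ (ch (E := E) p).symm z :=
    (contMDiffOn_extChartAt_symm p).contMDiffAt ((ch_target_open p).mem_nhds hz)
  have h2 := ContMDiffAt.clm_bundle_apply (F₁ := E) (F₂ := E)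
    (E₁ := fun p : M ↦ TangentSpace 𝓘(ℝ, E) p) (E₂ := fun p : M ↦ TangentSpace 𝓘(ℝ, E) p)
    (hJ.contMDiff ((ch (E := E) p).symm z)) (contMDiffAt_trSymm hs a)
  rw [Trivialization.contMDiffAt_section_iff (e := trivializationAt E (TangentSpace 𝓘(ℝ, E)) p)
    (by simpa using hs)] at h2
  have h3 := contMDiffAt_iff_contDiffAt.1 (h2.comp z h1)
  refine (h3.congr_of_eventuallyEq ?_).contDiffWithinAt
  filter_upwards [(ch_target_open (E := E) p).mem_nhds hz] with w hw
  exact tr_apply ((ch (E := E) p).map_target hw) _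

lemma differentiableAt_endo {y : M} (hy : y ∈ (ch (E := E) p).source) :
    DifferentiableAt ℝ (endo J p) (ch (E := E) p y) :=
  ((contDiffOn_endo hJ).contDiffAt ((ch_target_open p).mem_nhds
    (ch_mem_target hy))).differentiableAt (by simp)

/-- The closedness and integrability conditions at `p` are expressed by coordinate fields of the
chart at `p`, so `kaehler_parallel` applies directly only at the centre. -/
lemma parallel_at_center (x y : E) :
    fderiv ℝ (endo J p) (ch (E := E) p p) x y
      + chris (gram (E := E) p) (ch (E := E) p p) x (endo J p (ch (E := E) p p) y) =
    endo J p (ch (E := E) p p) (chris (gram (E := E) p) (ch (E := E) p p) x y) := by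
  have hp := mem_ch_source (E := E) p
  have hj := differentiableAt_endo hJ hp
  have hg := (isMetricOn_gram (E := E) p).differentiableAt (ch_mem_target hp)
  have target := (ch_target_open (E := E) p).mem_nhds (ch_mem_target hp)
  have fJ (u : TangentSpace 𝓘(ℝ, E) p) :
      fld (E := E) p p id (fun q ↦ J q (coordField 𝓘(ℝ, E) u q))
        =ᶠ[𝓝 (ch (E := E) p p)] fun z ↦ endo J p z (tr p p u) := by
    filter_upwards [target, fld_coordField u] with z h1 h2
    rw [fld_endo _ h1, h2]
  have dJ (u : TangentSpace 𝓘(ℝ, E) p) (a : E) :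
      fderiv ℝ (fld (E := E) p p id (fun q ↦ J q (coordField 𝓘(ℝ, E) u q))) (ch (E := E) p p) a =
        fderiv ℝ (endo J p) (ch (E := E) p p) a (tr p p u) := by
    rw [(fJ u).fderiv_eq, (hj.hasFDerivAt.clm_apply (hasFDerivAt_const _ _)).fderiv]
    simp
  refine kaehler_parallel (isMetricOn_gram (E := E) p) (ch_mem_target hp) hj ?_ ?_ ?_ ?_ x y
  · apply eventually_ch_self
    refine .of_forall ?_
    rintro _ ⟨y, hy, rfl⟩ a
    rw [← tr_trSymm hy a, endo_tr hy, endo_tr hy, hJ.sq_eq_neg, map_neg]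
  · apply eventually_ch_self
    refine .of_forall ?_
    rintro _ ⟨y, hy, rfl⟩ a b
    rw [← tr_trSymm hy a, ← tr_trSymm hy b, endo_tr hy, endo_tr hy, gram_tr hy, gram_tr hy,
      hJ.inner_map]
  · intro u v w
    have key (u v w : E) : mvfderiv 𝓘(ℝ, E) (fun q ↦ fundamentalForm 𝓘(ℝ, E) J q
        (coordField 𝓘(ℝ, E) (trSymm p p v) q) (coordField 𝓘(ℝ, E) (trSymm p p w) q)) p
          (trSymm p p u) =
        fderiv ℝ (fun z ↦ gram (E := E) p z v (endo J p z w)) (ch (E := E) p p) u := by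
      have heq : (fun q ↦ fundamentalForm 𝓘(ℝ, E) J q
          (coordField 𝓘(ℝ, E) (trSymm p p v) q) (coordField 𝓘(ℝ, E) (trSymm p p w) q)) ∘
          (ch (E := E) p).symm =ᶠ[𝓝 (ch (E := E) p p)]
          fun z ↦ gram (E := E) p z v (endo J p z w) := by
        apply eventually_ch_self
        refine .of_forall ?_
        rintro _ ⟨y, hy, rfl⟩
        rw [Function.comp_apply, (ch (E := E) p).left_inv hy, fundamentalForm, coordField_eq hy,
          coordField_eq hy, tr_trSymm hp, tr_trSymm hp, ← gram_tr hy, ← endo_tr hy, tr_trSymm hy,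
          tr_trSymm hy]
      have hd : DifferentiableAt ℝ (fun z ↦ gram (E := E) p z v (endo J p z w))
          (ch (E := E) p p) :=
        (hg.clm_apply (differentiableAt_const _)).clm_apply
          (hj.clm_apply (differentiableAt_const _))
      rw [mvfderiv_eq_fderiv hp (hd.congr_of_eventuallyEq heq), heq.fderiv_eq, tr_trSymm hp]
    rw [← key, ← key, ← key]
    exact hJ.closed p _ _ _
  · intro u v
    have h := congrArg (tr p p) (hJ.integrable p (trSymm p p u) (trSymm p p v))
    rw [nijenhuis, map_sub, map_sub, map_sub, ← endo_tr hp, ← endo_tr hp, tr_mlieBracket,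
      tr_mlieBracket, tr_mlieBracket, tr_mlieBracket, (fld_coordField _).fderiv_eq,
      (fld_coordField _).fderiv_eq, dJ, dJ, dJ, dJ] at h
    simp only [coordField_self, ← endo_tr hp, tr_trSymm hp, fderiv_fun_const, Pi.zero_apply,
      zero_apply, map_zero, sub_zero, zero_sub, map_neg] at h
    rw [← h]
    abel

/-- `J` is parallel for the Levi-Civita connection. -/
lemma leviCivita_map {W : (y : M) → TangentSpace 𝓘(ℝ, E) y}
    (hW : DifferentiableAt ℝ (fld (E := E) p p id W) (ch (E := E) p p))
    (v : TangentSpace 𝓘(ℝ, E) p) :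
    leviCivita 𝓘(ℝ, E) (fun q ↦ J q (W q)) p v = J p (leviCivita 𝓘(ℝ, E) W p v) := by
  have hp := mem_ch_source (E := E) p
  have target := (ch_target_open (E := E) p).mem_nhds (ch_mem_target hp)
  have heq : fld (E := E) p p id (fun q ↦ J q (W q)) =ᶠ[𝓝 (ch (E := E) p p)]
      fun z ↦ endo J p z (fld (E := E) p p id W z) := by
    filter_upwards [target] with z hz using fld_endo W hz
  have hd := ((differentiableAt_endo hJ hp).hasFDerivAt.clm_apply
    hW.hasFDerivAt).congr_of_eventuallyEq heq
  have f1 := fld_ch (E := E) (x := p) (p := p) (φ := id) W hp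
  apply tr_injective hp
  rw [tr_leviCivita hp hd.differentiableAt, ← endo_tr hp (W p),
    ← endo_tr hp (leviCivita 𝓘(ℝ, E) W p v), tr_leviCivita hp hW, hd.fderiv, f1, map_add,
    ← parallel_at_center hJ]
  simp only [add_apply, ContinuousLinearMap.comp_apply, ContinuousLinearMap.flip_apply]
  dsimp only [id]
  abel

/-- The chart-free identity `leviCivita_map`, proved at `y` in its own chart, is read back in the
chart at `p`. The equation thus holds on an open set, as needed to differentiate it in `curv_comm`.
-/
lemma parallel {y : M} (hy : y ∈ (ch (E := E) p).source) (a b : E) :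
    fderiv ℝ (endo J p) (ch (E := E) p y) a b
      + chris (gram (E := E) p) (ch (E := E) p y) a (endo J p (ch (E := E) p y) b) =
    endo J p (ch (E := E) p y) (chris (gram (E := E) p) (ch (E := E) p y) a b) := by
  have h := congrArg (tr p y) (leviCivita_map hJ
    (differentiableAt_fld_trSymm (mem_ch_source y) hy b) (trSymm p y a))
  have h1 : fld (E := E) p p id (fun q : M ↦ trSymm p q b) =ᶠ[𝓝 (ch (E := E) p y)]
      fun _ ↦ b := by
    filter_upwards [(ch_target_open (E := E) p).mem_nhds (ch_mem_target hy)] with z hz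
    exact tr_trSymm ((ch (E := E) p).map_target hz) b
  have h2 : fld (E := E) p p id (fun q : M ↦ J q (trSymm p q b)) =ᶠ[𝓝 (ch (E := E) p y)]
      fun z ↦ endo J p z b := by
    filter_upwards [(ch_target_open (E := E) p).mem_nhds (ch_mem_target hy), h1] with z hz hz'
    rw [fld_endo _ hz, hz']
  have hd := ((differentiableAt_endo hJ hy).hasFDerivAt.clm_apply
    (hasFDerivAt_const b _)).congr_of_eventuallyEq h2
  rw [tr_leviCivita hy hd.differentiableAt, ← endo_tr hy, ← endo_tr hy, tr_leviCivita hy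
    ((differentiableAt_const _).congr_of_eventuallyEq h1), hd.fderiv, h1.fderiv_eq,
    tr_trSymm hy, tr_trSymm hy] at h
  simpa using h

/-- The Riemannian symmetries come from the local formulas. Invariance under `J` in the last pair
holds because the parallel `J` commutes with the curvature operators and is orthogonal. -/
lemma isKaehlerCurvature_curvature (p : M) :
    IsKaehlerCurvature (J p) (fun x y z w ↦ inner ℝ (curvature 𝓘(ℝ, E) p x y z) w) := by
  have hp := mem_ch_source (E := E) p
  have hm := isMetricOn_gram (E := E) p
  have hz := ch_mem_target hp
  have e (x y z w : TangentSpace 𝓘(ℝ, E) p) : inner ℝ (curvature 𝓘(ℝ, E) p x y z) w =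
      gram (E := E) p (ch (E := E) p p) (curv (chris (gram (E := E) p)) (ch (E := E) p p)
        (tr p p x) (tr p p y) (tr p p z)) (tr p p w) := by
    rw [← tr_curvature, gram_tr hp]
  have hcomm (x y z : TangentSpace 𝓘(ℝ, E) p) : curvature 𝓘(ℝ, E) p x y (J p z) =
      J p (curvature 𝓘(ℝ, E) p x y z) := by
    apply tr_injective hp
    rw [tr_curvature, ← endo_tr hp, ← endo_tr hp, tr_curvature]
    refine curv_comm (hm.hasFDerivAt_chris hz).differentiableAt
      (((contDiffOn_endo hJ).contDiffAt ((ch_target_open p).mem_nhds hz)).of_le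
        (WithTop.coe_le_coe.2 le_top)) ?_ _ _ _
    apply eventually_ch_self
    refine .of_forall ?_
    rintro _ ⟨y, hy, rfl⟩ a b
    exact parallel hJ hy a b
  constructor
  · intro x x' y z w
    rw [e, e, e, ← add_apply, ← map_add]
    congr 2
    simp only [curv, map_add, add_apply]
    abel
  · intro x y z w
    rw [e, e, curv_swap]
    simp
  · intro x y z w
    rw [e, e, eq_neg_iff_add_eq_zero, hm.symm _ hz (curv _ _ _ _ (tr p p w))]
    exact hm.curv_antisymm hz _ _ _ _
  · intro x y z w
    rw [e, e, e, ← add_apply, ← map_add, ← add_apply, ← map_add, hm.curv_bianchi hz]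
    simp
  · intro x y z w
    rw [hcomm, hJ.inner_map]

end Kaehler

section SpaceForm

variable {E' : Type*} [NormedAddCommGroup E'] [NormedSpace ℝ E'] [FiniteDimensional ℝ E']
  {N : Type*} [TopologicalSpace N] [ChartedSpace E' N] [IsManifold 𝓘(ℝ, E') ∞ N]
  [RiemannianBundle (fun x : N ↦ TangentSpace 𝓘(ℝ, E') x)]
  [IsContMDiffRiemannianBundle 𝓘(ℝ, E') ∞ E' (fun x : N ↦ TangentSpace 𝓘(ℝ, E') x)]
  {J : (p : N) → TangentSpace 𝓘(ℝ, E') p →L[ℝ] TangentSpace 𝓘(ℝ, E') p} {ε : ℝ} {φ : M → N}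

/-- The curvature term of the bitension field of a Lagrangian immersion in a complex space
form. -/
theorem metricTrace_curvature_lagrangian (hN : IsComplexSpaceForm 𝓘(ℝ, E') J (4 * ε))
    (hφ : IsIsometricImmersion 𝓘(ℝ, E) 𝓘(ℝ, E') φ) (hL : IsLagrangian 𝓘(ℝ, E) 𝓘(ℝ, E') J φ)
    (hdim : Module.finrank ℝ E' = 2 * Module.finrank ℝ E) (x : M)
    {h : TangentSpace 𝓘(ℝ, E') (φ x)}
    (hh : ∀ c, inner ℝ h (mfderiv 𝓘(ℝ, E) 𝓘(ℝ, E') φ x c) = 0) :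
    (metricTrace 𝓘(ℝ, E) x fun u v ↦ curvature 𝓘(ℝ, E') (φ x) h
      (mfderiv 𝓘(ℝ, E) 𝓘(ℝ, E') φ x u) (mfderiv 𝓘(ℝ, E) 𝓘(ℝ, E') φ x v)) =
      (((Module.finrank ℝ E : ℝ) + 3) * ε) • h := by
  have hJ := hN.isKaehler
  have hK := isKaehlerCurvature_curvature hJ (φ x)
  have hJx (v : TangentSpace 𝓘(ℝ, E') (φ x)) : inner ℝ v (J (φ x) v) = 0 := by
    have h1 := hJ.inner_map (φ x) v (J (φ x) v)
    rw [hJ.sq_eq_neg, inner_neg_right, real_inner_comm] at h1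
    linarith
  refine ext_inner_right ℝ fun w ↦ ?_
  rw [metricTrace, sum_inner, inner_smul_left]
  refine IsKaehlerCurvature.sum_lagrangian (J := (J (φ x)).toLinearMap) (hJ.sq_eq_neg _)
    (hJ.inner_map _) hK ?_ hdim
    (e := fun i ↦ mfderiv 𝓘(ℝ, E) 𝓘(ℝ, E') φ x
      (stdOrthonormalBasis ℝ (TangentSpace 𝓘(ℝ, E) x) i)) ?_ ?_ ?_ w
  -- The plane of `v` and `J v` has denominator `‖v‖ ^ 4`, by orthogonality and `‖J v‖ = ‖v‖`. The
  -- zero vector spans no plane and is treated apart.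
  · intro v
    rcases eq_or_ne v 0 with rfl | hv
    · simp
    · have h1 := hN.sectionalCurvature_eq (φ x) v hv
      have h2 : ‖J (φ x) v‖ ^ 2 = ‖v‖ ^ 2 := by
        rw [← real_inner_self_eq_norm_sq, hJ.inner_map, real_inner_self_eq_norm_sq]
      rw [sectionalCurvature, hJx, h2, div_eq_iff] at h1
      · refine h1.trans ?_
        ring
      · have := norm_pos_iff.2 hv
        rw [zero_pow two_ne_zero, sub_zero]
        positivity
  · rw [orthonormal_iff_ite]
    intro i j
    rw [hφ.inner_mfderiv]
    exact orthonormal_iff_ite.1 (stdOrthonormalBasis ℝ (TangentSpace 𝓘(ℝ, E) x)).orthonormal i j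
  · exact fun i j ↦ hL x _ _
  · exact fun i ↦ hh _

end SpaceForm

end

/-! ### The bitension field of a Lagrangian immersion. -/

section

variable {E : Type*} [NormedAddCommGroup E] [NormedSpace ℝ E] [FiniteDimensional ℝ E]
  {M : Type*} [TopologicalSpace M] [ChartedSpace E M] [IsManifold 𝓘(ℝ, E) ∞ M]
  [RiemannianBundle (fun x : M ↦ TangentSpace 𝓘(ℝ, E) x)]
  [IsContMDiffRiemannianBundle 𝓘(ℝ, E) ∞ E (fun x : M ↦ TangentSpace 𝓘(ℝ, E) x)]
  {E' : Type*} [NormedAddCommGroup E'] [NormedSpace ℝ E'] [FiniteDimensional ℝ E']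
  {N : Type*} [TopologicalSpace N] [ChartedSpace E' N] [IsManifold 𝓘(ℝ, E') ∞ N]
  [RiemannianBundle (fun x : N ↦ TangentSpace 𝓘(ℝ, E') x)]
  [IsContMDiffRiemannianBundle 𝓘(ℝ, E') ∞ E' (fun x : N ↦ TangentSpace 𝓘(ℝ, E') x)]
  {J : (p : N) → TangentSpace 𝓘(ℝ, E') p →L[ℝ] TangentSpace 𝓘(ℝ, E') p} {ε : ℝ} {φ : M → N}

/-- The bitension field of a Lagrangian immersion in a complex space form, split into its
tangential and normal parts. -/
theorem bitensionField_lagrangian (hN : IsComplexSpaceForm 𝓘(ℝ, E') J (4 * ε))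
    (hφ : IsIsometricImmersion 𝓘(ℝ, E) 𝓘(ℝ, E') φ) (hL : IsLagrangian 𝓘(ℝ, E) 𝓘(ℝ, E') J φ)
    (hdim : Module.finrank ℝ E' = 2 * Module.finrank ℝ E) (hE : Module.finrank ℝ E ≠ 0) (x : M) :
    bitensionField 𝓘(ℝ, E) 𝓘(ℝ, E') φ x = (Module.finrank ℝ E : ℝ) •
      (mfderiv 𝓘(ℝ, E) 𝓘(ℝ, E') φ x
        (metricTrace 𝓘(ℝ, E) x (covShapeOperator 𝓘(ℝ, E) 𝓘(ℝ, E') φ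
            (meanCurvature 𝓘(ℝ, E) 𝓘(ℝ, E') φ) x)
          + metricTrace 𝓘(ℝ, E) x (shapeNormalDeriv 𝓘(ℝ, E) 𝓘(ℝ, E') φ
            (meanCurvature 𝓘(ℝ, E) 𝓘(ℝ, E') φ) x))
        + (normalLaplacian 𝓘(ℝ, E) 𝓘(ℝ, E') φ (meanCurvature 𝓘(ℝ, E) 𝓘(ℝ, E') φ) x
          + metricTrace 𝓘(ℝ, E) x (fun u v ↦ secondFundForm 𝓘(ℝ, E) 𝓘(ℝ, E') φ x
            (shapeOperator 𝓘(ℝ, E) 𝓘(ℝ, E') φ (meanCurvature 𝓘(ℝ, E) 𝓘(ℝ, E') φ) x u) v)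
          - (((Module.finrank ℝ E : ℝ) + 3) * ε) • meanCurvature 𝓘(ℝ, E) 𝓘(ℝ, E') φ x)) := by
  have hH (y : M) := smoothAlongAt_meanCurvature (x := y) hφ.contMDiff
  rw [bitensionField, metricTrace_curvature_lagrangian hN hφ hL hdim, tensionField_eq_smul
    fun h ↦ absurd h hE, roughLaplacian_const_smul hφ.contMDiff _ hH,
    roughLaplacian_eq hφ.contMDiff (hH x), ← add_sub_assoc, smul_sub, smul_comm _ (_ * ε)]
  -- The Lagrangian trace formula requires the tension field to be normal, which it is as a multiple
  -- of the mean curvature.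
  intro c
  rw [tensionField_eq_smul fun h ↦ absurd h hE, inner_smul_left,
    inner_meanCurvature hφ.inner_mfderiv hφ.contMDiff, mul_zero]

/-- Each of the three terms is normal by itself. Values of `B` are normal whatever their arguments,
so `A` may be any map. -/
lemma inner_normalEquation (hφ : IsIsometricImmersion 𝓘(ℝ, E) 𝓘(ℝ, E') φ) {x : M} (a : ℝ)
    (A : TangentSpace 𝓘(ℝ, E) x → TangentSpace 𝓘(ℝ, E) x) (c : TangentSpace 𝓘(ℝ, E) x) :
    inner ℝ (normalLaplacian 𝓘(ℝ, E) 𝓘(ℝ, E') φ (meanCurvature 𝓘(ℝ, E) 𝓘(ℝ, E') φ) x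
      + metricTrace 𝓘(ℝ, E) x (fun u v ↦ secondFundForm 𝓘(ℝ, E) 𝓘(ℝ, E') φ x (A u) v)
      - a • meanCurvature 𝓘(ℝ, E) 𝓘(ℝ, E') φ x) (mfderiv 𝓘(ℝ, E) 𝓘(ℝ, E') φ x c) = 0 := by
  have hi := hφ.inner_mfderiv
  rw [inner_sub_left, inner_add_left, inner_normalLaplacian hi, inner_smul_left,
    inner_meanCurvature hi hφ.contMDiff, metricTrace, sum_inner,
    Finset.sum_eq_zero fun i _ ↦ inner_secondFundForm hφ.contMDiff hi .., mul_zero, add_zero,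
    sub_zero]

end

end

end LagrangianGeom

theorem proposition3p1 (m : ℕ)
    {M : Type*} [TopologicalSpace M] [T2Space M] [SecondCountableTopology M]
    [ChartedSpace (EuclideanSpace ℝ (Fin m)) M] [IsManifold (𝓡 m) ∞ M]
    [RiemannianBundle (fun x : M ↦ TangentSpace (𝓡 m) x)]
    [IsContMDiffRiemannianBundle (𝓡 m) ∞ (EuclideanSpace ℝ (Fin m))
      (fun x : M ↦ TangentSpace (𝓡 m) x)]
    {N : Type*} [TopologicalSpace N] [T2Space N] [SecondCountableTopology N]
    [ChartedSpace (EuclideanSpace ℝ (Fin (2 * m))) N] [IsManifold (𝓡 (2 * m)) ∞ N]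
    [RiemannianBundle (fun y : N ↦ TangentSpace (𝓡 (2 * m)) y)]
    [IsContMDiffRiemannianBundle (𝓡 (2 * m)) ∞ (EuclideanSpace ℝ (Fin (2 * m)))
      (fun y : N ↦ TangentSpace (𝓡 (2 * m)) y)]
    (J : (p : N) → TangentSpace (𝓡 (2 * m)) p →L[ℝ] TangentSpace (𝓡 (2 * m)) p)
    (ε : ℝ) (hN : IsComplexSpaceForm (𝓡 (2 * m)) J (4 * ε))
    (φ : M → N) (hφ : IsIsometricImmersion (𝓡 m) (𝓡 (2 * m)) φ)
    (hL : IsLagrangian (𝓡 m) (𝓡 (2 * m)) J φ) :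
    IsBiharmonic (𝓡 m) (𝓡 (2 * m)) φ ↔
      (∀ x : M,
        metricTrace (𝓡 m) x
            (covShapeOperator (𝓡 m) (𝓡 (2 * m)) φ (meanCurvature (𝓡 m) (𝓡 (2 * m)) φ) x)
          + metricTrace (𝓡 m) x
            (shapeNormalDeriv (𝓡 m) (𝓡 (2 * m)) φ (meanCurvature (𝓡 m) (𝓡 (2 * m)) φ) x)
          = 0) ∧
      (∀ x : M,
        normalLaplacian (𝓡 m) (𝓡 (2 * m)) φ (meanCurvature (𝓡 m) (𝓡 (2 * m)) φ) x
          + metricTrace (𝓡 m) x (fun u v ↦ secondFundForm (𝓡 m) (𝓡 (2 * m)) φ x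
              (shapeOperator (𝓡 m) (𝓡 (2 * m)) φ (meanCurvature (𝓡 m) (𝓡 (2 * m)) φ) x u) v)
          - (((m : ℝ) + 3) * ε) • meanCurvature (𝓡 m) (𝓡 (2 * m)) φ x
          = 0) := by
  have hf (k : ℕ) : Module.finrank ℝ (EuclideanSpace ℝ (Fin k)) = k := finrank_euclideanSpace_fin
  rw [← forall_and]
  refine forall_congr' fun x ↦ ?_
  -- For `m = 0` all tangent spaces are zero and every equation holds; otherwise the factor `m` of
  -- the bitension field can be cancelled.
  rcases eq_or_ne m 0 with rfl | hm
  · refine iff_of_true ?_ ⟨?_, ?_⟩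
    · exact @Subsingleton.elim (EuclideanSpace ℝ (Fin 0)) _ _ _
    · exact @Subsingleton.elim (EuclideanSpace ℝ (Fin 0)) _ _ _
    · exact @Subsingleton.elim (EuclideanSpace ℝ (Fin 0)) _ _ _
  · rw [LagrangianGeom.bitensionField_lagrangian hN hφ hL (by rw [hf, hf]) (by rwa [hf]), hf,
      smul_eq_zero_iff_right (Nat.cast_ne_zero.2 hm)]
    exact LagrangianGeom.mfderiv_add_eq_zero_iff hφ.inner_mfderiv _ fun c ↦
      LagrangianGeom.inner_normalEquation hφ _ _ c
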